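/- Let $n\ge 1$, let $\langle Z,W\rangle=Z_1\bar W_1+\dots+Z_n\bar W_n-Z_{n+1}\bar W_{n+1}$ on $\mathbb C^{n+1}$, and let $G=SU(n,1)$ be the group of unimodular matrices preserving this form. $G$ acts on the unit ball $B^n\subset\mathbb C^n$ by fractional linear transformations (a point $z$ being represented by the vector $(z,1)$); if $(c_1,\dots,c_n,d)$ is the last row of $g$, put $j(g,z)=(c_1z_1+\dots+c_nz_n+d)^{-1}$. For $t\in\mathbb R$ let $a_t\in G$ be the identity on the first $n-1$ coordinates and $\left(\begin{smallmatrix}\cosh t&\sinh t\\ \sinh t&\cosh t\end{smallmatrix}\right)$ on the last two, and let $W$ be the group of block diagonal elements of $G$ (elements of $S(U(n)\times U(1))$) commuting with all $a_t$. An element of $G$ is called loxodromic if it is conjugate in $G$ to some $a_tw$ with $w\in W$, $t\neq0$. The geodesics of $B^n$ are the images under $G$ of $\{(0,\dots,0,\tanh t):t\in\mathbb R\}$; the axis of a loxodromic element is the unique geodesic which it maps onto itself. A loxodromic $g$ has exactly one repelling fixed point $X$ and one attracting fixed point $Y$ on $\partial B^n$; put $Q_g(z)=\langle z,X\rangle\langle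 z,Y\rangle$, where $z,X,Y$ are represented by $(z,1),(X,1),(Y,1)$. Let $\Gamma$ be a lattice in $G$. A loxodromic element $\gamma_0\in\Gamma$ is called primitive if it is not a proper power up to elements of $\Gamma$ fixing its axis pointwise: whenever $\gamma_0=\delta^kw$ with $\delta,w\in\Gamma$, $k\ge 0$ an integer, and $w$ fixing the axis of $\gamma_0$ pointwise, then $k=1$. Let $\kappa\ge1$ with $\kappa\in\frac12\mathbb Z$ and $(n+1)\kappa\in\mathbb Z$. For a function $f$ on $B^n$ and $g\in G$ put $(f|g)(z)=f(gz)\,j(g,z)^{2(n+1)\kappa}$. For a loxodromic $\gamma_0\in\Gamma$ let $q_{\gamma_0}=Q_{\gamma_0}^{-(n+1)\kappa}$, and suppose that $q_{\gamma_0}$ is an automorphic form for $\langle\gamma_0\rangle$, i.e. $q_{\gamma_0}|\gamma=q_{\gamma_0}$ on $B^n$ for all $\gamma\in\langle\gamma_0\rangle$. Then $q_{\gamma_0}|\gamma$ depends only on the coset $\langle\gamma_0\rangle\gamma$, and the relative Poincaré series of $\gamma_0$ is $$\Theta_{\gamma_0,\kappa}(z)=\sum_{\gamma\in\langle\gamma_0\rangle\backslash\Gamma}(q_{\gamma_0}|\gamma)(z),\qquad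 z\in B^n .$$ Corollary. Let $\gamma_0,\gamma_1\in\Gamma$ be two primitive loxodromic elements having the same axis, such that $q_{\gamma_0}$ is automorphic for $\langle\gamma_0\rangle$ and $q_{\gamma_1}$ is automorphic for $\langle\gamma_1\rangle$ (so that both series are defined). Then both series converge absolutely at every point of $B^n$, and $\Theta_{\gamma_0,\kappa}=\Theta_{\gamma_1,\kappa}$. -/

import Mathlib

open scoped BigOperators

namespace ComplexHyperbolic

noncomputable section

/-- Index set of `ℂ^{n,1}`: the first `n` coordinates are `Sum.inl i`, the last one is
`Sum.inr ()`. -/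
abbrev Idx (n : ℕ) := Fin n ⊕ Unit

/-- The Hermitian form `⟨Z, W⟩ = Z₁ W̄₁ + ⋯ + Zₙ W̄ₙ - Zₙ₊₁ W̄ₙ₊₁` on `ℂ^{n,1}`. -/
def herm {n : ℕ} (Z W : Idx n → ℂ) : ℂ :=
  (∑ i : Fin n, Z (Sum.inl i) * star (W (Sum.inl i))) -
    Z (Sum.inr ()) * star (W (Sum.inr ()))

/-- The group `SU(n,1)` of unimodular complex matrices preserving `⟨ , ⟩`, with the topology
induced from the space of matrices. -/
def SU (n : ℕ) : Subgroup (Matrix.SpecialLinearGroup (Idx n) ℂ) where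
  carrier := {A | ∀ Z W : Idx n → ℂ, herm (A.1.mulVec Z) (A.1.mulVec W) = herm Z W}
  mul_mem' := by
    intro A B hA hB Z W
    simp only [Matrix.SpecialLinearGroup.coe_mul, ← Matrix.mulVec_mulVec]
    rw [hA, hB]
  one_mem' := by
    intro Z W
    simp
  inv_mem' := by
    intro A hA Z W
    rw [← hA]
    simp only [Matrix.mulVec_mulVec, ← Matrix.SpecialLinearGroup.coe_mul]
    simp

/-- The underlying matrix of an element of `SU(n,1)`. -/
def mat {n : ℕ} (g : SU n) : Matrix (Idx n) (Idx n) ℂ := g.1.1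

/-- The vector `(z, 1)` of `ℂ^{n,1}` representing the point `z` of `ℂⁿ`. -/
def lift1 {n : ℕ} (z : Fin n → ℂ) : Idx n → ℂ := Sum.elim z (fun _ => 1)

/-- The open unit ball `Bⁿ` of `ℂⁿ`, the ball model of complex hyperbolic space. -/
def unitBall (n : ℕ) : Set (Fin n → ℂ) := {z | ∑ i, ‖z i‖ ^ 2 < 1}

/-- The action of `SU(n,1)` by fractional linear transformations: `g(z)` has the coordinates
`(a_{i1} z₁ + ⋯ + a_{in} zₙ + bᵢ) / (c₁ z₁ + ⋯ + cₙ zₙ + d)`. -/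
def act {n : ℕ} (g : SU n) (z : Fin n → ℂ) : Fin n → ℂ :=
  fun i => (mat g).mulVec (lift1 z) (Sum.inl i) / (mat g).mulVec (lift1 z) (Sum.inr ())

/-- The cocycle `j(g,z) = (c₁ z₁ + ⋯ + cₙ zₙ + d)⁻¹`. -/
def j {n : ℕ} (g : SU n) (z : Fin n → ℂ) : ℂ := ((mat g).mulVec (lift1 z) (Sum.inr ()))⁻¹

/-- The one-parameter group `a_t`: the identity on the first `n - 1` coordinates and
`(cosh t, sinh t; sinh t, cosh t)` on the last two. -/
def flow (n : ℕ) (t : ℝ) : Matrix (Idx n) (Idx n) ℂ :=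
  Matrix.fromBlocks
    (Matrix.diagonal fun i : Fin n => if i.val + 1 = n then (Real.cosh t : ℂ) else 1)
    (Matrix.of fun (i : Fin n) (_ : Unit) => if i.val + 1 = n then (Real.sinh t : ℂ) else 0)
    (Matrix.of fun (_ : Unit) (i : Fin n) => if i.val + 1 = n then (Real.sinh t : ℂ) else 0)
    (Matrix.of fun (_ : Unit) (_ : Unit) => (Real.cosh t : ℂ))

/-- The maximal compact subgroup `K = S(U(n) × U(1))`: the block diagonal elements. -/
def IsInK {n : ℕ} (g : SU n) : Prop := (mat g).toBlocks₁₂ = 0 ∧ (mat g).toBlocks₂₁ = 0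

/-- The subgroup `W` of the elements of `K` which commute with all `a_t`. -/
def IsInW {n : ℕ} (g : SU n) : Prop :=
  IsInK g ∧ ∀ t : ℝ, mat g * flow n t = flow n t * mat g

/-- `g` is loxodromic: it is conjugate in `SU(n,1)` to an element `a_t w` of the centralizer
`A W` of `A` with `w ∈ W` and non-trivial `A`-component, `t ≠ 0`. -/
def IsLoxodromic {n : ℕ} (g : SU n) : Prop :=
  ∃ (h w : SU n) (t : ℝ), t ≠ 0 ∧ IsInW w ∧ mat g * mat h = mat h * (flow n t * mat w)

/-- The standard geodesic `{(0, …, 0, tanh t) : t ∈ ℝ}` of `Bⁿ`, the orbit of `0` under the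
group of the `a_t`. -/
def stdGeodesic (n : ℕ) : Set (Fin n → ℂ) :=
  {z | ∃ t : ℝ, z = fun i => if i.val + 1 = n then (Real.tanh t : ℂ) else 0}

/-- The (complete) geodesics of `Bⁿ`: the images of the standard one under `SU(n,1)`. -/
def IsGeodesic {n : ℕ} (C : Set (Fin n → ℂ)) : Prop :=
  ∃ h : SU n, C = act h '' stdGeodesic n

/-- `C` is the axis of the loxodromic element `g`: the geodesic mapped onto itself by `g`. -/
def IsAxis {n : ℕ} (g : SU n) (C : Set (Fin n → ℂ)) : Prop :=
  IsGeodesic C ∧ act g '' C = C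

/-- `X` is the repelling fixed point of `g` on the boundary sphere: `(X, 1)` is a null
eigenvector of `g` with eigenvalue of absolute value less than `1`. -/
def IsRepelling {n : ℕ} (g : SU n) (X : Fin n → ℂ) : Prop :=
  herm (lift1 X) (lift1 X) = 0 ∧
    ∃ μ : ℂ, ‖μ‖ < 1 ∧ (mat g).mulVec (lift1 X) = μ • lift1 X

/-- `Y` is the attracting fixed point of `g` on the boundary sphere: `(Y, 1)` is a null
eigenvector of `g` with eigenvalue of absolute value greater than `1`. -/
def IsAttracting {n : ℕ} (g : SU n) (Y : Fin n → ℂ) : Prop :=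
  herm (lift1 Y) (lift1 Y) = 0 ∧
    ∃ μ : ℂ, 1 < ‖μ‖ ∧ (mat g).mulVec (lift1 Y) = μ • lift1 Y

theorem herm_mat {n : ℕ} (g : SU n) (Z W : Idx n → ℂ) :
    herm ((mat g).mulVec Z) ((mat g).mulVec W) = herm Z W := g.2 Z W

theorem mat_mul {n : ℕ} (g h : SU n) : mat (g * h) = mat g * mat h := rfl

theorem herm_self {n : ℕ} (Z : Idx n → ℂ) :
    herm Z Z = ((∑ i : Fin n, ‖Z (Sum.inl i)‖ ^ 2 - ‖Z (Sum.inr ())‖ ^ 2 : ℝ) : ℂ) := by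
  simp only [herm, Complex.star_def, Complex.mul_conj, Complex.normSq_eq_norm_sq]
  push_cast
  rfl

theorem mem_unitBall_iff {n : ℕ} (z : Fin n → ℂ) :
    z ∈ unitBall n ↔
      ∑ i : Fin n, ‖lift1 z (Sum.inl i)‖ ^ 2 - ‖lift1 z (Sum.inr ())‖ ^ 2 < 0 := by
  simp [unitBall, lift1]

theorem neg_mulVec {n : ℕ} (g : SU n) {z : Fin n → ℂ} (hz : z ∈ unitBall n) :
    ∑ i : Fin n, ‖(mat g).mulVec (lift1 z) (Sum.inl i)‖ ^ 2
      - ‖(mat g).mulVec (lift1 z) (Sum.inr ())‖ ^ 2 < 0 := by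
  have h := herm_mat g (lift1 z) (lift1 z)
  rw [herm_self, herm_self, Complex.ofReal_inj] at h
  rw [h]
  exact (mem_unitBall_iff z).1 hz

theorem denom_ne_zero {n : ℕ} (g : SU n) {z : Fin n → ℂ} (hz : z ∈ unitBall n) :
    (mat g).mulVec (lift1 z) (Sum.inr ()) ≠ 0 := by
  intro h0
  have h := neg_mulVec g hz
  rw [h0] at h
  have : 0 ≤ ∑ i : Fin n, ‖(mat g).mulVec (lift1 z) (Sum.inl i)‖ ^ 2 :=
    Finset.sum_nonneg fun _ _ => sq_nonneg _
  simp at h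
  linarith

theorem lift1_act {n : ℕ} (g : SU n) {z : Fin n → ℂ} (hz : z ∈ unitBall n) :
    (mat g).mulVec (lift1 z) = (mat g).mulVec (lift1 z) (Sum.inr ()) • lift1 (act g z) := by
  have h := denom_ne_zero g hz
  funext i
  rcases i with i | i
  · simp only [lift1, act, Pi.smul_apply, Sum.elim_inl, smul_eq_mul]
    exact (mul_div_cancel₀ _ h).symm
  · simp [lift1]

theorem act_mem {n : ℕ} (g : SU n) {z : Fin n → ℂ} (hz : z ∈ unitBall n) :
    act g z ∈ unitBall n := by
  have h := neg_mulVec g hz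
  have h0 := denom_ne_zero g hz
  have hp : 0 < ‖(mat g).mulVec (lift1 z) (Sum.inr ())‖ ^ 2 := by positivity
  simp only [unitBall, Set.mem_ofPred_eq, act, norm_div, div_pow]
  rw [← Finset.sum_div, div_lt_one hp]
  linarith

theorem mulVec_mul_lift1 {n : ℕ} (g h : SU n) {z : Fin n → ℂ} (hz : z ∈ unitBall n) :
    (mat (g * h)).mulVec (lift1 z) =
      (mat h).mulVec (lift1 z) (Sum.inr ()) • (mat g).mulVec (lift1 (act h z)) := by
  rw [mat_mul, ← Matrix.mulVec_mulVec]
  conv_lhs => rw [lift1_act h hz]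
  rw [Matrix.mulVec_smul]

theorem act_mul {n : ℕ} (g h : SU n) {z : Fin n → ℂ} (hz : z ∈ unitBall n) :
    act (g * h) z = act g (act h z) := by
  funext i
  simp only [act]
  rw [mulVec_mul_lift1 g h hz]
  simp only [Pi.smul_apply, smul_eq_mul]
  rw [mul_div_mul_left _ _ (denom_ne_zero h hz)]

theorem j_mul {n : ℕ} (g h : SU n) {z : Fin n → ℂ} (hz : z ∈ unitBall n) :
    j (g * h) z = j g (act h z) * j h z := by
  simp only [j]
  rw [mulVec_mul_lift1 g h hz]
  simp [mul_comm]

theorem eq_of_null {n : ℕ} {X X' : Fin n → ℂ} (h : herm (lift1 X) (lift1 X) = 0)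
    (h' : herm (lift1 X') (lift1 X') = 0) (h0 : herm (lift1 X) (lift1 X') = 0) : X = X' := by
  have e : (∑ i, (X i - X' i) * star (X i - X' i)) = 0 := by
    have h1 : herm (lift1 X') (lift1 X) = 0 := by
      have := congrArg star h0
      simpa [herm, lift1, mul_comm] using this
    simp only [herm, lift1, Sum.elim_inl, Sum.elim_inr, star_one, mul_one, sub_eq_zero]
      at h h' h0 h1
    simp only [star_sub, sub_mul, mul_sub, Finset.sum_sub_distrib]
    rw [h, h', h0, h1]
    simp
  have e' : ((∑ i, ‖X i - X' i‖ ^ 2 : ℝ) : ℂ) = 0 := by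
    rw [← e]
    push_cast
    refine Finset.sum_congr rfl fun i _ => ?_
    rw [Complex.star_def, Complex.mul_conj, Complex.normSq_eq_norm_sq]
    push_cast
    rfl
  rw [Complex.ofReal_eq_zero, Finset.sum_eq_zero_iff_of_nonneg fun _ _ => sq_nonneg _] at e'
  funext i
  have := e' i (Finset.mem_univ i)
  rw [sq_eq_zero_iff, norm_eq_zero, sub_eq_zero] at this
  exact this

theorem herm_smul_smul {n : ℕ} (a b : ℂ) (Z W : Idx n → ℂ) :
    herm (a • Z) (b • W) = a * star b * herm Z W := by
  simp only [herm, Pi.smul_apply, smul_eq_mul, star_mul', mul_sub, Finset.mul_sum]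
  congr 1
  · exact Finset.sum_congr rfl fun _ _ => by ring
  · ring

theorem herm_eq_zero_of_eigen {n : ℕ} (g : SU n) {Z W : Idx n → ℂ} {a b : ℂ}
    (hZ : (mat g).mulVec Z = a • Z) (hW : (mat g).mulVec W = b • W) (h : ‖a‖ * ‖b‖ ≠ 1) :
    herm Z W = 0 := by
  have e := herm_mat g Z W
  rw [hZ, hW, herm_smul_smul] at e
  by_contra h0
  apply h
  have : a * star b = 1 := mul_right_cancel₀ h0 (by rw [e, one_mul])
  rw [← norm_star b, ← norm_mul, this, norm_one]

theorem IsRepelling.unique {n : ℕ} {g : SU n} {X X' : Fin n → ℂ} (h : IsRepelling g X)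
    (h' : IsRepelling g X') : X = X' := by
  obtain ⟨h1, a, ha, hX⟩ := h
  obtain ⟨h2, b, hb, hX'⟩ := h'
  refine eq_of_null h1 h2 (herm_eq_zero_of_eigen g hX hX' (ne_of_lt ?_))
  nlinarith [norm_nonneg a, norm_nonneg b]

theorem IsAttracting.unique {n : ℕ} {g : SU n} {Y Y' : Fin n → ℂ} (h : IsAttracting g Y)
    (h' : IsAttracting g Y') : Y = Y' := by
  obtain ⟨h1, a, ha, hX⟩ := h
  obtain ⟨h2, b, hb, hX'⟩ := h'
  refine eq_of_null h1 h2 (herm_eq_zero_of_eigen g hX hX' (ne_of_gt ?_))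
  nlinarith [norm_nonneg a, norm_nonneg b]

/-- The null vector `(0, …, 0, 1, s)` for `s = 1` or `s = -1`. -/
def endVec (n : ℕ) (s : ℂ) : Idx n → ℂ :=
  Sum.elim (fun i => if i.val + 1 = n then 1 else 0) (fun _ => s)

theorem sum_last {n : ℕ} (hn : 1 ≤ n) (f : Fin n → ℂ) :
    (∑ i : Fin n, if i.val + 1 = n then f i else 0) = f ⟨n - 1, by omega⟩ := by
  rw [Finset.sum_eq_single ⟨n - 1, by omega⟩]
  · simp; omega
  · intro b _ hb
    have : b.val + 1 ≠ n := fun h => hb (Fin.ext (by simp; omega))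
    simp [this]
  · simp

theorem flow_endVec {n : ℕ} (hn : 1 ≤ n) (t : ℝ) {s : ℂ} (hs : s * s = 1) :
    (flow n t).mulVec (endVec n s) =
      ((Real.cosh t : ℂ) + s * (Real.sinh t : ℂ)) • endVec n s := by
  funext i
  rcases i with i | i
  · have := sum_last hn (fun x => if i = x then (if i.val + 1 = n then (Complex.cosh t) else 1)
      else 0)
    simp only [flow, endVec, Matrix.mulVec, dotProduct, Matrix.fromBlocks, Fintype.sum_sum_type]
    simp [Matrix.diagonal_apply] at this ⊢
    rw [this]
    have hi : i = ⟨n - 1, by omega⟩ ↔ i.val + 1 = n := by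
      rw [Fin.ext_iff]
      simp only
      omega
    simp only [hi]
    split_ifs <;> ring
  · have := sum_last hn (fun x => if x.val + 1 = n then Complex.sinh t else 0)
    simp only [flow, endVec, Matrix.mulVec, dotProduct, Matrix.fromBlocks, Fintype.sum_sum_type]
    simp at this ⊢
    rw [this]
    have hl : n - 1 + 1 = n := by omega
    simp only [hl, if_true]
    linear_combination (- Complex.sinh t) * hs

theorem IsInW.endVec {n : ℕ} (hn : 1 ≤ n) {w : SU n} (hw : IsInW w) :
    ∃ d : ℂ, ‖d‖ = 1 ∧ ∀ s : ℂ, (mat w).mulVec (endVec n s) = d • endVec n s := by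
  obtain ⟨⟨hk1, hk2⟩, hc⟩ := hw
  have h1 : ∀ i, mat w (Sum.inl i) (Sum.inr ()) = 0 := fun i => congrFun (congrFun hk1 i) ()
  have h2 : ∀ i, mat w (Sum.inr ()) (Sum.inl i) = 0 := fun i => congrFun (congrFun hk2 ()) i
  have hsinh : (Complex.sinh 1 : ℂ) ≠ 0 := by
    have : Real.sinh 1 ≠ 0 := by simp
    have h := Complex.ofReal_ne_zero.2 this
    simpa using h
  have h3 : ∀ i, mat w (Sum.inl i) (Sum.inl ⟨n - 1, by omega⟩) =
      if i.val + 1 = n then mat w (Sum.inr ()) (Sum.inr ()) else 0 := by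
    intro i
    have h := congrFun (congrFun (hc 1) (Sum.inl i)) (Sum.inr ())
    simp only [Matrix.mul_apply, Fintype.sum_sum_type, flow, Matrix.fromBlocks,
      Matrix.of_apply, Sum.elim_inl, Sum.elim_inr, mul_ite, mul_zero, h1] at h
    rw [sum_last hn (fun x => mat w (Sum.inl i) (Sum.inl x) * (Real.sinh 1 : ℂ))] at h
    simp only [Finset.univ_unique, Finset.sum_singleton, Finset.sum_const_zero] at h
    simp at h
    split_ifs at h ⊢
    · exact mul_right_cancel₀ hsinh (by rw [h]; simp [mul_comm])
    · simpa [hsinh] using h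
  refine ⟨mat w (Sum.inr ()) (Sum.inr ()), ?_, ?_⟩
  · have h := herm_mat w (Pi.single (Sum.inr ()) 1) (Pi.single (Sum.inr ()) 1)
    rw [herm_self, herm_self, Complex.ofReal_inj] at h
    simp [h1] at h
    rcases h with h | h
    · exact h
    · linarith [norm_nonneg (mat w (Sum.inr ()) (Sum.inr ()))]
  · intro s
    funext i
    rcases i with i | i
    · simp only [ComplexHyperbolic.endVec, Matrix.mulVec, dotProduct, Fintype.sum_sum_type,
        Sum.elim_inl, Sum.elim_inr, mul_ite, mul_one, mul_zero, h1, zero_mul]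
      rw [sum_last hn (fun x => mat w (Sum.inl i) (Sum.inl x)), h3]
      simp
    · simp [ComplexHyperbolic.endVec, Matrix.mulVec, dotProduct, h2]

theorem IsLoxodromic.exists_eigen {n : ℕ} (hn : 1 ≤ n) {g : SU n} (hg : IsLoxodromic g) :
    ∃ t : ℝ, t ≠ 0 ∧ ∀ s : ℂ, s * s = 1 → ∃ (X : Fin n → ℂ) (d : ℂ), ‖d‖ = 1 ∧
      herm (lift1 X) (lift1 X) = 0 ∧ (mat g).mulVec (lift1 X) =
        (((Real.cosh t : ℂ) + s * (Real.sinh t : ℂ)) * d) • lift1 X := by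
  obtain ⟨h, w, t, ht, hw, hgh⟩ := hg
  refine ⟨t, ht, fun s hs => ?_⟩
  obtain ⟨d, hd, hdw⟩ := hw.endVec hn
  set V := (mat h).mulVec (endVec n s) with hV
  have hs1 : ‖s‖ = 1 := by
    have := congrArg norm hs
    rw [norm_mul, norm_one] at this
    nlinarith [norm_nonneg s]
  have hgV : (mat g).mulVec V = (((Real.cosh t : ℂ) + s * (Real.sinh t : ℂ)) * d) • V := by
    rw [hV, Matrix.mulVec_mulVec, hgh, ← Matrix.mulVec_mulVec, ← Matrix.mulVec_mulVec, hdw,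
      Matrix.mulVec_smul, flow_endVec hn t hs, Matrix.mulVec_smul, Matrix.mulVec_smul, smul_smul,
      mul_comm d]
  have hnull : herm V V = 0 := by
    rw [hV, herm_mat]
    have := sum_last hn (fun _ => (1 : ℂ))
    have e : s * star s = 1 := by
      rw [Complex.star_def, Complex.mul_conj, Complex.normSq_eq_norm_sq, hs1]
      simp
    simp only [herm, endVec, Sum.elim_inl, Sum.elim_inr, e]
    simp [← ite_and] at this ⊢
    rw [this]
    simp
  have hV0 : V (Sum.inr ()) ≠ 0 := by
    intro h0
    rw [herm_self, Complex.ofReal_eq_zero, h0] at hnull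
    simp only [norm_zero, ne_eq, OfNat.ofNat_ne_zero, not_false_eq_true, zero_pow, sub_zero]
      at hnull
    rw [Finset.sum_eq_zero_iff_of_nonneg fun _ _ => sq_nonneg _] at hnull
    have hVz : V = 0 := by
      funext i
      rcases i with i | i
      · simpa using hnull i (Finset.mem_univ i)
      · exact h0
    have hinv : (mat h⁻¹).mulVec V = endVec n s := by
      rw [hV, Matrix.mulVec_mulVec, ← mat_mul, inv_mul_cancel]
      exact Matrix.one_mulVec _
    rw [hVz, Matrix.mulVec_zero] at hinv
    have : s = 0 := (congrFun hinv (Sum.inr ())).symm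
    rw [this] at hs1
    simp at hs1
  have hl : lift1 (fun i => V (Sum.inl i) / V (Sum.inr ())) = (V (Sum.inr ()))⁻¹ • V := by
    funext i
    rcases i with i | i
    · simp [lift1, div_eq_inv_mul]
    · simp [lift1, hV0]
  refine ⟨fun i => V (Sum.inl i) / V (Sum.inr ()), d, hd, ?_, ?_⟩
  · rw [hl, herm_smul_smul, hnull, mul_zero]
  · rw [hl, Matrix.mulVec_smul, hgV, smul_comm]

theorem norm_cosh_add (t : ℝ) (d : ℂ) (hd : ‖d‖ = 1) :
    ‖((Real.cosh t : ℂ) + 1 * (Real.sinh t : ℂ)) * d‖ = Real.exp t := by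
  rw [norm_mul, hd, mul_one, one_mul, ← Complex.ofReal_add, Real.cosh_add_sinh,
    Complex.norm_real, Real.norm_eq_abs, abs_of_pos (Real.exp_pos t)]

theorem norm_cosh_sub (t : ℝ) (d : ℂ) (hd : ‖d‖ = 1) :
    ‖((Real.cosh t : ℂ) + (-1) * (Real.sinh t : ℂ)) * d‖ = Real.exp (-t) := by
  rw [norm_mul, hd, mul_one, neg_one_mul, ← sub_eq_add_neg, ← Complex.ofReal_sub,
    Real.cosh_sub_sinh, Complex.norm_real, Real.norm_eq_abs, abs_of_pos (Real.exp_pos _)]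

theorem IsLoxodromic.existsUnique_ends {n : ℕ} (hn : 1 ≤ n) {g : SU n} (hg : IsLoxodromic g) :
    (∃! X, IsRepelling g X) ∧ ∃! Y, IsAttracting g Y := by
  obtain ⟨t, ht, h⟩ := hg.exists_eigen hn
  obtain ⟨X, d, hd, hX, hgX⟩ := h 1 (by norm_num)
  obtain ⟨Y, e, he, hY, hgY⟩ := h (-1) (by norm_num)
  have nX := norm_cosh_add t d hd
  have nY := norm_cosh_sub t e he
  rcases lt_or_gt_of_ne ht with ht | ht
  · refine ⟨⟨X, ⟨hX, _, ?_, hgX⟩, fun _ h' => h'.unique ⟨hX, _, ?_, hgX⟩⟩,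
      ⟨Y, ⟨hY, _, ?_, hgY⟩, fun _ h' => h'.unique ⟨hY, _, ?_, hgY⟩⟩⟩
    all_goals first | rw [nX] | rw [nY]
    all_goals first | rw [Real.exp_lt_one_iff] | rw [Real.one_lt_exp_iff]
    all_goals linarith
  · refine ⟨⟨Y, ⟨hY, _, ?_, hgY⟩, fun _ h' => h'.unique ⟨hY, _, ?_, hgY⟩⟩,
      ⟨X, ⟨hX, _, ?_, hgX⟩, fun _ h' => h'.unique ⟨hX, _, ?_, hgX⟩⟩⟩
    all_goals first | rw [nX] | rw [nY]
    all_goals first | rw [Real.exp_lt_one_iff] | rw [Real.one_lt_exp_iff]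
    all_goals linarith

/-- The repelling boundary fixed point `X` of `g` (it exists and is unique if `g` is
loxodromic, see `IsLoxodromic.existsUnique_ends`). -/
def repellingPoint {n : ℕ} (g : SU n) : Fin n → ℂ := Classical.epsilon (IsRepelling g)

/-- The attracting boundary fixed point `Y` of `g` (it exists and is unique if `g` is
loxodromic, see `IsLoxodromic.existsUnique_ends`). -/
def attractingPoint {n : ℕ} (g : SU n) : Fin n → ℂ := Classical.epsilon (IsAttracting g)

/-- `Q_g(z) = ⟨z, X⟩ ⟨z, Y⟩`, where `X` and `Y` are the repelling and the attracting fixed point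
of `g` and where points `z` are represented by the vectors `(z, 1)`. -/
def Q {n : ℕ} (g : SU n) (z : Fin n → ℂ) : ℂ :=
  herm (lift1 z) (lift1 (repellingPoint g)) * herm (lift1 z) (lift1 (attractingPoint g))

/-- The function `q = 1 / Q_g^m`, where `m = (n+1)κ`. -/
def q {n : ℕ} (g : SU n) (m : ℕ) (z : Fin n → ℂ) : ℂ := 1 / Q g z ^ m

/-- The operator `(f|g)(z) = f(g z) j(g,z)^{2m}`; with `m = (n+1)κ` this is the operator
attached to the automorphy factor `j(g,z)^{2(n+1)κ}`. -/
def slash {n : ℕ} (m : ℕ) (f : (Fin n → ℂ) → ℂ) (g : SU n) (z : Fin n → ℂ) : ℂ :=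
  f (act g z) * j g z ^ (2 * m)

/-- `f` transforms under the group `Γ₀ ⊆ Γ` like an automorphic form of type
`j(g,z)^{2m}` on `Bⁿ`: `f|g = f` for all `g ∈ Γ₀`. -/
def IsAutomorphicFor {n : ℕ} {Γ : Subgroup (SU n)} (Γ₀ : Subgroup Γ) (m : ℕ)
    (f : (Fin n → ℂ) → ℂ) : Prop :=
  ∀ g ∈ Γ₀, ∀ z ∈ unitBall n, slash m f (g : SU n) z = f z

theorem slash_mul {n : ℕ} (m : ℕ) (f : (Fin n → ℂ) → ℂ) (g h : SU n) {z : Fin n → ℂ}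
    (hz : z ∈ unitBall n) : slash m f (g * h) z = slash m (slash m f g) h z := by
  simp only [slash]
  rw [act_mul g h hz, j_mul g h hz, mul_pow, mul_assoc]

/-- The term `(f|γ)(z)` of the relative Poincaré series, as a function of the coset `Γ₀ γ` in
`Γ₀ \ Γ`; it is well defined because `f` is automorphic for `Γ₀`. -/
def relPoincareTerm {n : ℕ} {Γ : Subgroup (SU n)} (Γ₀ : Subgroup Γ) (m : ℕ)
    (f : (Fin n → ℂ) → ℂ) (hf : IsAutomorphicFor Γ₀ m f) (z : unitBall n) :
    Quotient (QuotientGroup.rightRel Γ₀) → ℂ :=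
  Quotient.lift (fun γ : Γ => slash m f (γ : SU n) z) (by
    intro a b hab
    have hab' : b * a⁻¹ ∈ Γ₀ := QuotientGroup.rightRel_apply.1 hab
    have hb : ((b : Γ) : SU n) = ((b * a⁻¹ : Γ) : SU n) * (a : SU n) := by simp
    change slash m f (a : SU n) z = slash m f (b : SU n) z
    rw [hb, slash_mul m f _ _ z.2]
    simp only [slash]
    have := hf _ hab' _ (act_mem (a : SU n) z.2)
    simp only [slash] at this
    rw [this])

/-- `Γ` is a lattice in `SU(n,1)`: it is discrete and `Γ \ SU(n,1)` has finite Haar measure. -/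
def IsLattice {n : ℕ} (Γ : Subgroup (SU n)) : Prop :=
  DiscreteTopology Γ ∧
    letI : MeasurableSpace (SU n) := borel (SU n)
    ∃ (ν : MeasureTheory.Measure (SU n)) (F : Set (SU n)), ν.IsHaarMeasure ∧
      MeasureTheory.IsFundamentalDomain Γ F ν ∧ ν F < ⊤

/-- The loxodromic element `γ₀` of `Γ` is primitive: up to elements of `Γ` fixing its axis
pointwise, `γ₀` is not a proper power of an element of `Γ`.  In other words, `γ₀` runs through
the closed geodesic of `Γ \ Bⁿ` given by its axis exactly once. -/
def IsPrimitive {n : ℕ} {Γ : Subgroup (SU n)} (γ₀ : Γ) : Prop :=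
  ∀ C : Set (Fin n → ℂ), IsAxis (γ₀ : SU n) C →
    ∀ (δ w : Γ) (k : ℕ), (∀ z ∈ C, act (w : SU n) z = z) → γ₀ = δ ^ k * w → k = 1

/-- The set `𝒦_n` of the `κ ≥ 1` in `½ ℤ` with `(n+1) κ ∈ ℤ`. -/
def admissible (n : ℕ) : Set ℚ :=
  {κ | 1 ≤ κ ∧ (∃ k : ℤ, κ = k / 2) ∧ ∃ m : ℤ, ((n : ℚ) + 1) * κ = m}

/-- The natural number `(n+1) κ`, for `κ ∈ 𝒦_n`. -/
def weight (n : ℕ) (κ : ℚ) : ℕ := ⌊((n : ℚ) + 1) * κ⌋₊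

theorem weight_cast {n : ℕ} {κ : ℚ} (hκ : κ ∈ admissible n) :
    (weight n κ : ℚ) = ((n : ℚ) + 1) * κ := by
  obtain ⟨h1, -, m, hm⟩ := hκ
  have h0 : (0 : ℚ) ≤ ((n : ℚ) + 1) * κ := by positivity
  rw [hm] at h0
  have hm0 : (0 : ℤ) ≤ m := by exact_mod_cast h0
  obtain ⟨k, rfl⟩ := Int.eq_ofNat_of_zero_le hm0
  rw [weight, hm]
  simp

/-- The condition that `q = 1 / Q_{γ₀}^{(n+1)κ}` is an automorphic form of type
`j(g,z)^{2(n+1)κ}` for the cyclic group `Γ₀ = ⟨γ₀⟩`, i.e. that the terms `q|γ` of the series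
`Θ_{γ₀,κ}` depend only on the cosets `Γ₀ γ`. -/
def HasTheta {n : ℕ} {Γ : Subgroup (SU n)} (γ₀ : Γ) (κ : ℚ) : Prop :=
  IsAutomorphicFor (Subgroup.zpowers γ₀) (weight n κ) (q (γ₀ : SU n) (weight n κ))

/-- The terms `(q|γ)(z)`, `γ ∈ ⟨γ₀⟩ \ Γ`, of the series `Θ_{γ₀,κ}(z)`. -/
def thetaTerm {n : ℕ} {Γ : Subgroup (SU n)} (γ₀ : Γ) (κ : ℚ) (h : HasTheta γ₀ κ)
    (z : unitBall n) : Quotient (QuotientGroup.rightRel (Subgroup.zpowers γ₀)) → ℂ :=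
  relPoincareTerm (Subgroup.zpowers γ₀) (weight n κ) (q (γ₀ : SU n) (weight n κ)) h z

/-- The relative Poincaré series `Θ_{γ₀,κ}(z) = ∑_{γ ∈ ⟨γ₀⟩ \ Γ} (q|γ)(z)`. -/
def Theta {n : ℕ} {Γ : Subgroup (SU n)} (γ₀ : Γ) (κ : ℚ) (h : HasTheta γ₀ κ)
    (z : unitBall n) : ℂ :=
  ∑' c, thetaTerm γ₀ κ h z c

end

end ComplexHyperbolic

namespace ComplexHyperbolic

/-! `Q` depends only on the two ends of the axis, and symmetrically, so both elements yield the same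
`q` (`Q_eq_of_axis`); only the cyclic groups whose cosets index the sums differ. On the subgroup of
`Γ` fixing both ends, the absolute value of the eigenvalue at one end is a homomorphism to the
positive reals. By discreteness its kernel, whose elements fix the axis pointwise, is finite, and
its image, which is nontrivial, has a least value above 1. Primitivity forces each of the two
elements to map to this generator of the image or to its inverse. After possibly inverting one
element, equal powers of the two differ by elements of a finite kernel, and the pigeonhole principle
yields a common power with the same exponent `N` on both sides (`exists_zpowers_pow_eq`). Summing
over the cosets of the common subgroup counts each series exactly `N` times (`tsum_rightRel_eq`),
and `N` cancels.

Cancelling requires convergence. If `d` is the last diagonal entry of `γ`, the images of a fixed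
open set of negative vectors under `γ / (3|d|)` lie in one ball, have volume proportional to
`|d|^(-2(n+1))`, and overlap boundedly often; hence `summable_inv_norm_lastEntry`. Since `|j(γ,z)|`
is at most a constant over `|d|` and `(n+1)κ ≥ n+1`, the sum of `|j(γ,z)|^(2(n+1)κ)` over `Γ`
converges. In each coset a representative can be chosen that moves `z` into a fundamental region of
`⟨γ₀⟩` on which `q` is bounded (`exists_zpow_act_mem`), and `summable_relPoincareTerm` follows by
comparison. -/

/-! ### Size of a matrix in `SU(n,1)` in terms of its last diagonal entry -/

theorem herm_single_left {n : ℕ} (Z : Idx n → ℂ) (i : Fin n) :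
    herm Z (Pi.single (Sum.inl i) 1) = Z (Sum.inl i) := by
  simp [herm, Pi.single_apply]

theorem herm_single_right {n : ℕ} (Z : Idx n → ℂ) :
    herm Z (Pi.single (Sum.inr ()) 1) = -Z (Sum.inr ()) := by
  simp [herm]

theorem star_herm {n : ℕ} (Z W : Idx n → ℂ) : star (herm Z W) = herm W Z := by
  simp [herm, mul_comm]

theorem mat_inv_mulVec {n : ℕ} (g : SU n) (Z : Idx n → ℂ) :
    (mat g⁻¹).mulVec ((mat g).mulVec Z) = Z := by
  rw [Matrix.mulVec_mulVec, ← mat_mul, inv_mul_cancel]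
  exact Matrix.one_mulVec _

theorem mat_mulVec_inv {n : ℕ} (g : SU n) (Z : Idx n → ℂ) :
    (mat g).mulVec ((mat g⁻¹).mulVec Z) = Z := by
  rw [Matrix.mulVec_mulVec, ← mat_mul, mul_inv_cancel]
  exact Matrix.one_mulVec _

theorem herm_mat_left {n : ℕ} (g : SU n) (Z W : Idx n → ℂ) :
    herm ((mat g).mulVec Z) W = herm Z ((mat g⁻¹).mulVec W) := by
  rw [← herm_mat g Z, mat_mulVec_inv]

/-- The last diagonal entry of a matrix of `SU(n,1)`. -/
noncomputable def lastEntry {n : ℕ} (g : SU n) : ℂ := mat g (Sum.inr ()) (Sum.inr ())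

/-- Up to signs, the inverse is the conjugate transpose, so the last row of `g` has the same
absolute values as the last column of `g⁻¹`. That column is the image of the last basis vector and
still has norm `-1`. -/
theorem sum_norm_sq_lastRow {n : ℕ} (g : SU n) :
    ∑ i, ‖mat g (Sum.inr ()) (Sum.inl i)‖ ^ 2 = ‖lastEntry g‖ ^ 2 - 1 := by
  have key : ∀ k : Idx n, star (mat g⁻¹ k (Sum.inr ())) =
      herm (Pi.single k 1) ((mat g⁻¹).mulVec (Pi.single (Sum.inr ()) 1)) *
        (Sum.elim (fun _ => 1) (fun _ => -1) k) := by
    intro k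
    rw [← star_herm]
    rcases k with i | i
    · rw [herm_single_left]; simp
    · rw [herm_single_right]; simp
  have key2 : ∀ k : Idx n, ‖mat g⁻¹ k (Sum.inr ())‖ = ‖mat g (Sum.inr ()) k‖ := by
    intro k
    rw [← norm_star, key, norm_mul, ← herm_mat_left, herm_single_right]
    rcases k with i | i <;> simp
  have h := herm_mat g⁻¹ (Pi.single (Sum.inr ()) 1) (Pi.single (Sum.inr ()) 1)
  rw [herm_self, herm_self, Complex.ofReal_inj] at h
  simp [key2] at h
  rw [lastEntry]
  linarith

theorem one_le_norm_lastEntry {n : ℕ} (g : SU n) : 1 ≤ ‖lastEntry g‖ := by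
  have h := sum_norm_sq_lastRow g
  have : 0 ≤ ∑ i, ‖mat g (Sum.inr ()) (Sum.inl i)‖ ^ 2 :=
    Finset.sum_nonneg fun _ _ => sq_nonneg _
  nlinarith [norm_nonneg (lastEntry g)]

/-- Each column has Hermitian norm `1` or `-1`, so its entries are controlled by its entry in the
last row, and the last row is controlled by `sum_norm_sq_lastRow`. -/
theorem norm_entry_le {n : ℕ} (g : SU n) (i k : Idx n) : ‖mat g i k‖ ≤ ‖lastEntry g‖ := by
  have hrow : ∀ k, ‖mat g (Sum.inr ()) (Sum.inl k)‖ ^ 2 ≤ ‖lastEntry g‖ ^ 2 - 1 := fun k => by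
    rw [← sum_norm_sq_lastRow]
    exact Finset.single_le_sum (f := fun i => ‖mat g (Sum.inr ()) (Sum.inl i)‖ ^ 2)
      (fun _ _ => sq_nonneg _) (Finset.mem_univ k)
  have hcol := herm_mat g (Pi.single k 1) (Pi.single k 1)
  rw [herm_self, herm_self, Complex.ofReal_inj] at hcol
  refine abs_le_of_sq_le_sq' ?_ (norm_nonneg _) |>.2
  rcases i with i | i
  · have hi := Finset.single_le_sum (f := fun i => ‖mat g (Sum.inl i) k‖ ^ 2)
      (fun _ _ => sq_nonneg _) (Finset.mem_univ i)
    rcases k with k | k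
    · have := hrow k
      simp [Pi.single_apply, apply_ite] at hcol hi
      linarith
    · simp [lastEntry] at hcol hi ⊢
      linarith
  · rcases k with k | k
    · linarith [hrow k]
    · exact le_rfl

/-- Cauchy–Schwarz on the last row, whose first `n` entries have Euclidean norm at most `|d|`. The
lower bound is useful for negative vectors, where `a` can be taken below the size of the last
coordinate. -/
theorem norm_mulVec_last {n : ℕ} (g : SU n) (v : Idx n → ℂ) {a : ℝ} (ha : 0 ≤ a)
    (hv : ∑ i, ‖v (Sum.inl i)‖ ^ 2 ≤ a ^ 2) :
    ‖lastEntry g‖ * (‖v (Sum.inr ())‖ - a) ≤ ‖(mat g).mulVec v (Sum.inr ())‖ ∧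
      ‖(mat g).mulVec v (Sum.inr ())‖ ≤ ‖lastEntry g‖ * (‖v (Sum.inr ())‖ + a) := by
  have hs : ‖∑ i, mat g (Sum.inr ()) (Sum.inl i) * v (Sum.inl i)‖ ≤ ‖lastEntry g‖ * a := by
    refine (norm_sum_le _ _).trans ?_
    simp only [norm_mul]
    refine abs_le_of_sq_le_sq' ?_ (by positivity) |>.2
    refine (Finset.sum_mul_sq_le_sq_mul_sq _ _ _).trans ?_
    rw [sum_norm_sq_lastRow, mul_pow]
    have := one_le_norm_lastEntry g
    exact mul_le_mul (by linarith) hv (Finset.sum_nonneg fun _ _ => sq_nonneg _) (by positivity)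
  have he : (mat g).mulVec v (Sum.inr ()) =
      ∑ i, mat g (Sum.inr ()) (Sum.inl i) * v (Sum.inl i) + lastEntry g * v (Sum.inr ()) := by
    simp [Matrix.mulVec, dotProduct, lastEntry]
  rw [he]
  set x := ∑ i, mat g (Sum.inr ()) (Sum.inl i) * v (Sum.inl i)
  constructor
  · have := norm_sub_le (x + lastEntry g * v (Sum.inr ())) x
    rw [add_sub_cancel_left, norm_mul] at this
    linarith
  · have := norm_add_le x (lastEntry g * v (Sum.inr ()))
    rw [norm_mul] at this
    linarith


/-! ### Discreteness as a finiteness statement -/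

theorem isClosedEmbedding_mat (n : ℕ) : Topology.IsClosedEmbedding (mat : SU n → _) := by
  refine ⟨Topology.IsEmbedding.subtypeVal.comp Topology.IsEmbedding.subtypeVal, ?_⟩
  have hr : Set.range (mat : SU n → _) = {A : Matrix (Idx n) (Idx n) ℂ | A.det = 1} ∩
      ⋂ Z : Idx n → ℂ, ⋂ W : Idx n → ℂ, {A | herm (A.mulVec Z) (A.mulVec W) = herm Z W} := by
    ext A
    simp only [Set.mem_range, Set.mem_inter_iff, Set.mem_iInter]
    constructor
    · rintro ⟨g, rfl⟩
      exact ⟨g.1.2, g.2⟩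
    · rintro ⟨h1, h2⟩
      exact ⟨⟨⟨A, h1⟩, h2⟩, rfl⟩
  rw [hr]
  refine (isClosed_eq (by fun_prop) continuous_const).inter
    (isClosed_iInter fun Z => isClosed_iInter fun W => isClosed_eq ?_ continuous_const)
  unfold herm
  simp only [Matrix.mulVec, dotProduct]
  fun_prop

/-- A bound on the last entry bounds all entries, hence confines `γ` to a compact part of the group,
which a discrete subgroup meets in a finite set. -/
theorem finite_norm_lastEntry_le {n : ℕ} {Γ : Subgroup (SU n)} (hΓ : DiscreteTopology Γ) (R : ℝ) :
    {γ : Γ | ‖lastEntry (γ : SU n)‖ ≤ R}.Finite := by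
  have hK : IsCompact (Set.univ.pi fun _ : Idx n => Set.univ.pi fun _ : Idx n =>
      Metric.closedBall (0 : ℂ) R) :=
    isCompact_univ_pi fun _ => isCompact_univ_pi fun _ => isCompact_closedBall _ _
  have hK' := (isClosedEmbedding_mat n).isCompact_preimage hK
  have hT := Γ.tendsto_coe_cofinite_of_discrete (isDiscrete_iff_discreteTopology.2 hΓ)
  have hc := hT hK'.compl_mem_cocompact
  refine (Filter.mem_cofinite.1 hc).subset fun γ hγ => ?_
  exact fun hn => hn fun i _ k _ => mem_closedBall_zero_iff.2 ((norm_entry_le _ i k).trans hγ)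

/-! ### Convergence over `Γ` by a packing argument in `ℂⁿ⁺¹` -/

open MeasureTheory

/-- An open set of negative vectors. -/
def packingSet (n : ℕ) : Set (Idx n → ℂ) :=
  {v | ∑ i, ‖v (Sum.inl i)‖ ^ 2 < (1 / 2) ^ 2 ∧ 1 < ‖v (Sum.inr ())‖ ∧ ‖v (Sum.inr ())‖ < 2}

theorem isOpen_packingSet (n : ℕ) : IsOpen (packingSet n) := by
  have h1 : Continuous fun v : Idx n → ℂ => ∑ i, ‖v (Sum.inl i)‖ ^ 2 := by fun_prop
  have h2 : Continuous fun v : Idx n → ℂ => ‖v (Sum.inr ())‖ := by fun_prop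
  exact (isOpen_lt h1 continuous_const).inter
    ((isOpen_lt continuous_const h2).inter (isOpen_lt h2 continuous_const))

theorem nonempty_packingSet (n : ℕ) : (packingSet n).Nonempty :=
  ⟨Sum.elim (fun _ => 0) (fun _ => 3 / 2), by norm_num [packingSet]⟩

theorem norm_mulVec_le_one_of_mem_packingSet {n : ℕ} (g : SU n) {v : Idx n → ℂ}
    (hv : v ∈ packingSet n) : ‖(mat g).mulVec v‖ ≤ 3 * ‖lastEntry g‖ := by
  obtain ⟨h1, h2, h3⟩ := hv
  have hl := (norm_mulVec_last g v (by norm_num) h1.le).2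
  have hd := one_le_norm_lastEntry g
  have hlast : ‖(mat g).mulVec v (Sum.inr ())‖ ≤ 3 * ‖lastEntry g‖ := by nlinarith
  have hneg := herm_mat g v v
  rw [herm_self, herm_self, Complex.ofReal_inj] at hneg
  refine (pi_norm_le_iff_of_nonneg (by positivity)).2 fun i => ?_
  rcases i with i | i
  · refine le_trans (abs_le_of_sq_le_sq' ?_ (norm_nonneg _)).2 hlast
    have := Finset.single_le_sum (f := fun i => ‖(mat g).mulVec v (Sum.inl i)‖ ^ 2)
      (fun _ _ => sq_nonneg _) (Finset.mem_univ i)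
    nlinarith
  · exact hlast

/-- The linear map `r g` with `r = 1 / (3 |d|)`, which sends `packingSet n` into the unit ball. -/
noncomputable def packingMap {n : ℕ} (g : SU n) : (Idx n → ℂ) →ₗ[ℂ] (Idx n → ℂ) :=
  (((3 * ‖lastEntry g‖)⁻¹ : ℝ) : ℂ) • Matrix.toLin' (mat g)

theorem packingMap_apply {n : ℕ} (g : SU n) (v : Idx n → ℂ) :
    packingMap g v = (((3 * ‖lastEntry g‖)⁻¹ : ℝ) : ℂ) • (mat g).mulVec v := rfl

/-- As `g` is unimodular, only the scalar contributes to the determinant; the factor 2 in the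
exponent comes from passing to the real determinant, the squared modulus of the complex one. -/
theorem volume_image_packingMap {n : ℕ} (g : SU n) (s : Set (Idx n → ℂ)) :
    volume (packingMap g '' s) =
      ENNReal.ofReal ((3 * ‖lastEntry g‖)⁻¹ ^ (2 * (n + 1))) * volume s := by
  have h := Measure.addHaar_image_linearMap volume ((packingMap g).restrictScalars ℝ) s
  have hdet : LinearMap.det (packingMap g) = (((3 * ‖lastEntry g‖)⁻¹ : ℝ) : ℂ) ^ (n + 1) := by
    rw [packingMap, LinearMap.det_smul, LinearMap.det_toLin']
    have : (mat g).det = 1 := g.1.2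
    simp [this]
  rw [LinearMap.det_restrictScalars, hdet, Algebra.norm_complex_apply, map_pow,
    Complex.normSq_ofReal] at h
  rw [← pow_two, ← pow_mul, abs_of_nonneg (by positivity)] at h
  exact h

/-- Comparing Hermitian norms shows that the two scalars are comparable. Then `g'⁻¹ g` sends `v` to
a vector with last coordinate at most `5`, while `norm_mulVec_last` bounds that coordinate below by
`|d| / 2`, where `d` is the last entry of `g'⁻¹ g`. -/
theorem packingMap_overlap {n : ℕ} {g g' : SU n} {v v' : Idx n → ℂ} (hv : v ∈ packingSet n)
    (hv' : v' ∈ packingSet n) (h : packingMap g v = packingMap g' v') :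
    ‖lastEntry (g'⁻¹ * g)‖ ≤ 10 := by
  rw [packingMap_apply, packingMap_apply] at h
  set r := (3 * ‖lastEntry g‖)⁻¹ with hr
  set r' := (3 * ‖lastEntry g'‖)⁻¹ with hr'
  have hd := one_le_norm_lastEntry g
  have hd' := one_le_norm_lastEntry g'
  have hr0 : 0 < r := by positivity
  have hr0' : 0 < r' := by positivity
  have hh : r ^ 2 * (∑ i, ‖v (Sum.inl i)‖ ^ 2 - ‖v (Sum.inr ())‖ ^ 2) =
      r' ^ 2 * (∑ i, ‖v' (Sum.inl i)‖ ^ 2 - ‖v' (Sum.inr ())‖ ^ 2) := by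
    have e := congrArg (fun Z => herm Z Z) h
    simp only [herm_smul_smul, herm_mat] at e
    simp only [herm_self, Complex.star_def, Complex.conj_ofReal, ← Complex.ofReal_mul,
      Complex.ofReal_inj] at e
    linarith
  have hl : r * ‖(mat (g'⁻¹ * g)).mulVec v (Sum.inr ())‖ = r' * ‖v' (Sum.inr ())‖ := by
    have e := congrArg (mat g'⁻¹).mulVec h
    rw [Matrix.mulVec_smul, Matrix.mulVec_smul, mat_inv_mulVec, Matrix.mulVec_mulVec,
      ← mat_mul] at e
    have e' := congrArg norm (congrFun e (Sum.inr ()))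
    simpa [abs_of_pos hr0, abs_of_pos hr0'] using e'
  obtain ⟨h1, h2, h3⟩ := hv
  obtain ⟨h1', h2', h3'⟩ := hv'
  have hlow := (norm_mulVec_last (g'⁻¹ * g) v (by norm_num) h1.le).1
  have hs : 0 ≤ ∑ i, ‖v (Sum.inl i)‖ ^ 2 := Finset.sum_nonneg fun _ _ => sq_nonneg _
  have hs' : 0 ≤ ∑ i, ‖v' (Sum.inl i)‖ ^ 2 := Finset.sum_nonneg fun _ _ => sq_nonneg _
  -- On `packingSet` the form takes values between `-4` and `-3/4`, so `(r'/r)² ≤ 16/3 < (5/2)²`.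
  have hrr : r' ≤ 5 / 2 * r := by
    refine (abs_le_of_sq_le_sq' ?_ (by positivity)).2
    have k1 : r' ^ 2 * (3 / 4) ≤
        r' ^ 2 * (‖v' (Sum.inr ())‖ ^ 2 - ∑ i, ‖v' (Sum.inl i)‖ ^ 2) :=
      mul_le_mul_of_nonneg_left (by nlinarith) (by positivity)
    have k2 : r ^ 2 * (‖v (Sum.inr ())‖ ^ 2 - ∑ i, ‖v (Sum.inl i)‖ ^ 2) ≤ r ^ 2 * 4 :=
      mul_le_mul_of_nonneg_left (by nlinarith) (by positivity)
    nlinarith [sq_nonneg r]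
  have hd2 := norm_nonneg (lastEntry (g'⁻¹ * g))
  have k3 : ‖lastEntry (g'⁻¹ * g)‖ * (1 / 2) ≤ ‖(mat (g'⁻¹ * g)).mulVec v (Sum.inr ())‖ := by
    nlinarith
  have k4 : r * ‖(mat (g'⁻¹ * g)).mulVec v (Sum.inr ())‖ ≤ r * 5 := by
    rw [hl]; nlinarith
  have k5 := le_of_mul_le_mul_left k4 hr0
  linarith

theorem summable_inv_norm_lastEntry {n : ℕ} {Γ : Subgroup (SU n)} (hΓ : DiscreteTopology Γ) :
    Summable fun γ : Γ => (‖lastEntry (γ : SU n)‖⁻¹) ^ (2 * (n + 1)) := by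
  classical
  set V := packingSet n
  set B : Set (Idx n → ℂ) := Metric.closedBall 0 1
  have hfin := finite_norm_lastEntry_le hΓ 10
  set N := hfin.toFinset.card
  have hVpos : 0 < volume V := (isOpen_packingSet n).measure_pos _ (nonempty_packingSet n)
  have hVsub : V ⊆ Metric.closedBall 0 2 := by
    intro v ⟨h1, h2, h3⟩
    rw [mem_closedBall_zero_iff]
    refine (pi_norm_le_iff_of_nonneg (by positivity)).2 fun i => ?_
    rcases i with i | i
    · have := Finset.single_le_sum (f := fun i => ‖v (Sum.inl i)‖ ^ 2)
        (fun _ _ => sq_nonneg _) (Finset.mem_univ i)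
      nlinarith [norm_nonneg (v (Sum.inl i))]
    · exact h3.le
  have hVfin : volume V ≠ ⊤ :=
    ((measure_mono hVsub).trans_lt (isCompact_closedBall 0 2).measure_lt_top).ne
  have hBfin : volume B ≠ ⊤ := (isCompact_closedBall 0 1).measure_lt_top.ne
  have hinj : ∀ g : SU n, Function.Injective (packingMap g) := by
    intro g v w h
    have h3 : (((3 * ‖lastEntry g‖)⁻¹ : ℝ) : ℂ) ≠ 0 := by
      have := one_le_norm_lastEntry g
      exact Complex.ofReal_ne_zero.2 (by positivity)
    rw [packingMap_apply, packingMap_apply] at h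
    have h4 := congrArg (mat g⁻¹).mulVec (smul_right_injective _ h3 h)
    rwa [mat_inv_mulVec, mat_inv_mulVec] at h4
  have hmeas : ∀ γ : Γ, MeasurableSet (packingMap (γ : SU n) '' V) := fun γ =>
    (isOpen_packingSet n).measurableSet.image_of_continuousOn_injOn
      (LinearMap.continuous_of_finiteDimensional _).continuousOn (hinj _).injOn
  have hsub : ∀ γ : Γ, packingMap (γ : SU n) '' V ⊆ B := by
    rintro γ _ ⟨v, hv, rfl⟩
    have := one_le_norm_lastEntry (γ : SU n)
    rw [mem_closedBall_zero_iff, packingMap_apply, norm_smul, Complex.norm_real,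
      Real.norm_of_nonneg (by positivity), inv_mul_le_one₀ (by positivity)]
    exact norm_mulVec_le_one_of_mem_packingSet _ hv
  -- Bounded multiplicity: if `Z` lies in the image belonging to `γ₁`, every other `γ` whose image
  -- contains `Z` has `γ₁⁻¹ γ` among the `N` elements with last entry at most 10.
  have hpt : ∀ (s : Finset Γ) (Z : Idx n → ℂ),
      ∑ γ ∈ s, (packingMap (γ : SU n) '' V).indicator (fun _ => (1 : ENNReal)) Z ≤
        B.indicator (fun _ => (N : ENNReal)) Z := by
    intro s Z
    simp only [Set.indicator_apply]
    rw [Finset.sum_boole]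
    by_cases hZ : ∃ γ₁ ∈ s, Z ∈ packingMap ((γ₁ : Γ) : SU n) '' V
    · obtain ⟨γ₁, -, h₁⟩ := hZ
      rw [if_pos (hsub γ₁ h₁), Nat.cast_le]
      refine Finset.card_le_card_of_injOn (fun γ => γ₁⁻¹ * γ) ?_
        fun _ _ _ _ h => mul_left_cancel h
      intro γ hγ
      obtain ⟨v, hv, rfl⟩ := (Finset.mem_filter.1 hγ).2
      obtain ⟨v', hv', h'⟩ := h₁
      exact hfin.mem_toFinset.2 (packingMap_overlap hv hv' h'.symm)
    · rw [Finset.filter_eq_empty_iff.2 fun γ hγ h => hZ ⟨γ, hγ, h⟩]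
      simp
  have hsum : ∀ s : Finset Γ, ∑ γ ∈ s,
      ENNReal.ofReal ((3 * ‖lastEntry (γ : SU n)‖)⁻¹ ^ (2 * (n + 1))) * volume V ≤
        N * volume B := by
    intro s
    calc _ = ∑ γ ∈ s, ∫⁻ Z, (packingMap (γ : SU n) '' V).indicator (fun _ => 1) Z := by
          refine Finset.sum_congr rfl fun γ _ => ?_
          rw [lintegral_indicator (hmeas γ), setLIntegral_one, volume_image_packingMap]
      _ = ∫⁻ Z, ∑ γ ∈ s, (packingMap (γ : SU n) '' V).indicator (fun _ => 1) Z := by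
          rw [lintegral_finsetSum]
          exact fun γ _ => measurable_const.indicator (hmeas γ)
      _ ≤ ∫⁻ Z, B.indicator (fun _ => (N : ENNReal)) Z := lintegral_mono (hpt s)
      _ = N * volume B := by
          rw [lintegral_indicator Metric.isClosed_closedBall.measurableSet, setLIntegral_const]
  have hS : Summable fun γ : Γ => (3 * ‖lastEntry (γ : SU n)‖)⁻¹ ^ (2 * (n + 1)) := by
    refine summable_of_sum_le (c := (N * volume B / volume V).toReal)
      (fun γ => by positivity) fun s => ?_
    have h := hsum s
    rw [← Finset.sum_mul, ← ENNReal.ofReal_sum_of_nonneg fun _ _ => by positivity] at h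
    rw [← ENNReal.ofReal_le_iff_le_toReal (ENNReal.div_ne_top (ENNReal.mul_ne_top (by simp) hBfin)
      hVpos.ne')]
    rwa [ENNReal.le_div_iff_mul_le (Or.inl hVpos.ne') (Or.inl hVfin)]
  refine (hS.mul_left (3 ^ (2 * (n + 1)))).congr fun γ => ?_
  rw [← mul_pow, mul_inv, mul_inv_cancel_left₀ (by norm_num)]


/-! ### Pairing with boundary points and eigenvectors -/

theorem herm_sub_left {n : ℕ} (Z Z' W : Idx n → ℂ) : herm (Z - Z') W = herm Z W - herm Z' W := by
  simp only [herm, Pi.sub_apply, sub_mul, Finset.sum_sub_distrib]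
  ring

theorem herm_sub_right {n : ℕ} (Z W W' : Idx n → ℂ) : herm Z (W - W') = herm Z W - herm Z W' := by
  rw [← star_herm, herm_sub_left, star_sub, star_herm, star_herm]

/-- The lifts have equal last coordinates, so the Euclidean distance is the Hermitian norm of their
difference; expand it using that `X` is null and `z` negative. -/
theorem sum_norm_sub_sq_lt {n : ℕ} {z X : Fin n → ℂ} (hz : z ∈ unitBall n)
    (hX : herm (lift1 X) (lift1 X) = 0) :
    ∑ i, ‖z i - X i‖ ^ 2 < 2 * ‖herm (lift1 z) (lift1 X)‖ := by
  have h := herm_self (lift1 z - lift1 X)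
  have h' := herm_self (lift1 z)
  rw [herm_sub_left, herm_sub_right, herm_sub_right, hX, ← star_herm (lift1 z) (lift1 X), h'] at h
  have hr := congrArg Complex.re h
  have hb := (mem_unitBall_iff z).1 hz
  simp only [lift1, Complex.star_def, Complex.sub_re, Complex.ofReal_re, Complex.conj_re,
    Complex.zero_re, Pi.sub_apply, Sum.elim_inl, Sum.elim_inr] at hr hb
  simp only [lift1] at *
  have := (abs_le.1 (Complex.abs_re_le_norm (herm (lift1 z) (lift1 X)))).1
  simp only [lift1] at this
  norm_num at hr hb
  linarith

theorem norm_herm_pos {n : ℕ} {z X : Fin n → ℂ} (hz : z ∈ unitBall n)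
    (hX : herm (lift1 X) (lift1 X) = 0) : 0 < ‖herm (lift1 z) (lift1 X)‖ := by
  have h := sum_norm_sub_sq_lt hz hX
  have : 0 ≤ ∑ i, ‖z i - X i‖ ^ 2 := Finset.sum_nonneg fun _ _ => sq_nonneg _
  linarith

/-- A point of the ball cannot be close to two distinct boundary points, so the two pairings are not
both small. This is what bounds `Q` away from zero. -/
theorem sum_norm_sub_sq_le {n : ℕ} {z X Y : Fin n → ℂ} (hz : z ∈ unitBall n)
    (hX : herm (lift1 X) (lift1 X) = 0) (hY : herm (lift1 Y) (lift1 Y) = 0) :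
    ∑ i, ‖X i - Y i‖ ^ 2 ≤
      4 * (‖herm (lift1 z) (lift1 X)‖ + ‖herm (lift1 z) (lift1 Y)‖) := by
  have h1 := sum_norm_sub_sq_lt hz hX
  have h2 := sum_norm_sub_sq_lt hz hY
  have h3 : ∑ i, ‖X i - Y i‖ ^ 2 ≤ ∑ i, (2 * ‖z i - X i‖ ^ 2 + 2 * ‖z i - Y i‖ ^ 2) := by
    refine Finset.sum_le_sum fun i _ => ?_
    have h4 := norm_sub_le (z i - Y i) (z i - X i)
    rw [sub_sub_sub_cancel_left] at h4
    nlinarith [sq_nonneg (‖z i - Y i‖ - ‖z i - X i‖), norm_nonneg (X i - Y i)]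
  rw [Finset.sum_add_distrib, ← Finset.mul_sum, ← Finset.mul_sum] at h3
  linarith

theorem eigen_ne_zero {n : ℕ} {g : SU n} {X : Fin n → ℂ} {μ : ℂ}
    (h : (mat g).mulVec (lift1 X) = μ • lift1 X) : μ ≠ 0 := by
  rintro rfl
  have e := mat_inv_mulVec g (lift1 X)
  rw [h, zero_smul, Matrix.mulVec_zero] at e
  have := congrFun e (Sum.inr ())
  simp [lift1] at this

theorem eigen_mul {n : ℕ} {g g' : SU n} {Z : Idx n → ℂ} {μ μ' : ℂ}
    (h : (mat g).mulVec Z = μ • Z) (h' : (mat g').mulVec Z = μ' • Z) :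
    (mat (g * g')).mulVec Z = (μ * μ') • Z := by
  rw [mat_mul, ← Matrix.mulVec_mulVec, h', Matrix.mulVec_smul, h, smul_smul, mul_comm]

theorem eigen_inv {n : ℕ} {g : SU n} {Z : Idx n → ℂ} {μ : ℂ} (hμ : μ ≠ 0)
    (h : (mat g).mulVec Z = μ • Z) : (mat g⁻¹).mulVec Z = μ⁻¹ • Z := by
  have e := mat_inv_mulVec g Z
  rw [h, Matrix.mulVec_smul] at e
  rw [← e, smul_smul, inv_mul_cancel₀ hμ, one_smul, e]

theorem eigen_pow {n : ℕ} {g : SU n} {Z : Idx n → ℂ} {μ : ℂ}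
    (h : (mat g).mulVec Z = μ • Z) (k : ℕ) : (mat (g ^ k)).mulVec Z = μ ^ k • Z := by
  induction k with
  | zero => simp only [pow_zero, one_smul]; exact Matrix.one_mulVec _
  | succ k ih => rw [pow_succ, pow_succ]; exact eigen_mul ih h

theorem eigen_zpow {n : ℕ} {g : SU n} {Z : Idx n → ℂ} {μ : ℂ} (hμ : μ ≠ 0)
    (h : (mat g).mulVec Z = μ • Z) (k : ℤ) : (mat (g ^ k)).mulVec Z = μ ^ k • Z := by
  cases k with
  | ofNat k => simpa using eigen_pow h k
  | negSucc k =>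
    rw [zpow_negSucc, zpow_negSucc]
    exact eigen_inv (pow_ne_zero _ hμ) (eigen_pow h _)

theorem norm_herm_act {n : ℕ} {g : SU n} {z X : Fin n → ℂ} (hz : z ∈ unitBall n) {μ : ℂ}
    (h : (mat g).mulVec (lift1 X) = μ • lift1 X) :
    ‖herm (lift1 (act g z)) (lift1 X)‖ = ‖j g z‖ * ‖μ‖⁻¹ * ‖herm (lift1 z) (lift1 X)‖ := by
  have e := herm_mat g (lift1 z) (lift1 X)
  rw [h, lift1_act g hz, herm_smul_smul] at e
  rw [← e, j, norm_inv, norm_mul, norm_mul, norm_star]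
  have h1 := norm_ne_zero_iff.2 (denom_ne_zero g hz)
  have h2 := norm_ne_zero_iff.2 (eigen_ne_zero h)
  field_simp

/-! ### Absolute convergence of the relative Poincaré series -/

theorem norm_j_le {n : ℕ} {z : Fin n → ℂ} (hz : z ∈ unitBall n) :
    ∃ C : ℝ, 0 ≤ C ∧ ∀ g : SU n, ‖j g z‖ ≤ C * ‖lastEntry g‖⁻¹ := by
  set a := √(∑ i, ‖z i‖ ^ 2) with ha
  have hs : 0 ≤ ∑ i, ‖z i‖ ^ 2 := Finset.sum_nonneg fun _ _ => sq_nonneg _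
  have ha1 : a < 1 := by
    rw [ha, Real.sqrt_lt' one_pos, one_pow]
    exact hz
  refine ⟨(1 - a)⁻¹, inv_nonneg.2 (by linarith), fun g => ?_⟩
  have h := (norm_mulVec_last g (lift1 z) (Real.sqrt_nonneg _) (Real.sq_sqrt hs).ge).1
  have hd := one_le_norm_lastEntry g
  rw [j, norm_inv, ← mul_inv, mul_comm]
  simp only [lift1, norm_one, Sum.elim_inr] at h
  exact inv_anti₀ (mul_pos (by linarith) (by linarith)) h

theorem summable_norm_j_pow {n : ℕ} {Γ : Subgroup (SU n)} (hΓ : DiscreteTopology Γ) {m : ℕ}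
    (hm : n + 1 ≤ m) {z : Fin n → ℂ} (hz : z ∈ unitBall n) :
    Summable fun γ : Γ => ‖j (γ : SU n) z‖ ^ (2 * m) := by
  obtain ⟨C, hC, h⟩ := norm_j_le hz
  refine Summable.of_nonneg_of_le (fun _ => by positivity) (fun γ => ?_)
    ((summable_inv_norm_lastEntry hΓ).mul_left (C ^ (2 * m)))
  refine (pow_le_pow_left₀ (norm_nonneg _) (h γ) _).trans ?_
  rw [mul_pow]
  refine mul_le_mul_of_nonneg_left ?_ (by positivity)
  exact pow_le_pow_of_le_one (by positivity) (inv_le_one_of_one_le₀ (one_le_norm_lastEntry _))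
    (by omega)

/-- The ratio of the pairings with `X` and `Y` is multiplied by `|ν| / |μ| > 1` under `g`, so some
power of `g` brings it between 1 and that factor. -/
theorem exists_zpow_act_mem {n : ℕ} {g : SU n} {X Y : Fin n → ℂ}
    (hX : herm (lift1 X) (lift1 X) = 0) (hY : herm (lift1 Y) (lift1 Y) = 0) {μ ν : ℂ}
    (hμ : (mat g).mulVec (lift1 X) = μ • lift1 X) (hν : (mat g).mulVec (lift1 Y) = ν • lift1 Y)
    (hμν : ‖μ‖ < ‖ν‖) {z : Fin n → ℂ} (hz : z ∈ unitBall n) :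
    ∃ k : ℤ, ‖herm (lift1 (act (g ^ k) z)) (lift1 Y)‖ ≤
        ‖herm (lift1 (act (g ^ k) z)) (lift1 X)‖ ∧
      ‖herm (lift1 (act (g ^ k) z)) (lift1 X)‖ ≤
        ‖ν‖ / ‖μ‖ * ‖herm (lift1 (act (g ^ k) z)) (lift1 Y)‖ := by
  have hμ0 : 0 < ‖μ‖ := norm_pos_iff.2 (eigen_ne_zero hμ)
  have hν0 : 0 < ‖ν‖ := norm_pos_iff.2 (eigen_ne_zero hν)
  have hxp := norm_herm_pos hz hX
  have hyp := norm_herm_pos hz hY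
  obtain ⟨k, hk, hk'⟩ := exists_mem_Ico_zpow (div_pos hxp hyp) ((one_lt_div hμ0).2 hμν)
  refine ⟨-k, ?_⟩
  rw [norm_herm_act hz (eigen_zpow (eigen_ne_zero hμ) hμ (-k)),
    norm_herm_act hz (eigen_zpow (eigen_ne_zero hν) hν (-k)), norm_zpow, norm_zpow,
    zpow_neg ‖μ‖, zpow_neg ‖ν‖, inv_inv, inv_inv]
  have hj : 0 ≤ ‖j (g ^ (-k)) z‖ := norm_nonneg _
  have hμk : 0 < ‖μ‖ ^ k := zpow_pos hμ0 k
  have hνk : 0 < ‖ν‖ ^ k := zpow_pos hν0 k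
  rw [div_zpow, div_le_div_iff₀ hμk hyp] at hk
  rw [zpow_add_one₀ (by positivity), div_zpow, div_lt_iff₀ hyp] at hk'
  constructor
  · rw [mul_assoc, mul_assoc]
    exact mul_le_mul_of_nonneg_left (by linarith) hj
  · rw [mul_assoc, mul_assoc, mul_left_comm (‖ν‖ / ‖μ‖)]
    refine mul_le_mul_of_nonneg_left ?_ hj
    have := mul_le_mul_of_nonneg_left hk'.le hμk.le
    refine this.trans (le_of_eq ?_)
    field_simp

theorem summable_relPoincareTerm {n : ℕ} {Γ : Subgroup (SU n)} (hΓ : DiscreteTopology Γ) (γ₀ : Γ)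
    {X Y : Fin n → ℂ} (hX : herm (lift1 X) (lift1 X) = 0) (hY : herm (lift1 Y) (lift1 Y) = 0)
    {μ ν : ℂ} (hμ : (mat (γ₀ : SU n)).mulVec (lift1 X) = μ • lift1 X)
    (hν : (mat (γ₀ : SU n)).mulVec (lift1 Y) = ν • lift1 Y) (hμν : ‖μ‖ < ‖ν‖) {m : ℕ}
    (hm : n + 1 ≤ m) {f : (Fin n → ℂ) → ℂ}
    (hfXY : ∀ z, f z = 1 / (herm (lift1 z) (lift1 X) * herm (lift1 z) (lift1 Y)) ^ m)
    (hf : IsAutomorphicFor (Subgroup.zpowers γ₀) m f) (z : unitBall n) :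
    Summable (relPoincareTerm (Subgroup.zpowers γ₀) m f hf z) := by
  have hXY : X ≠ Y := by
    rintro rfl
    have := congrFun (hμ.symm.trans hν) (Sum.inr ())
    simp only [lift1, Pi.smul_apply, Sum.elim_inr, smul_eq_mul, mul_one] at this
    exact hμν.ne (congrArg norm this)
  have hdist : 0 < ∑ i, ‖X i - Y i‖ ^ 2 := by
    obtain ⟨i, hi⟩ := Function.ne_iff.1 hXY
    refine Finset.sum_pos' (fun _ _ => sq_nonneg _) ⟨i, Finset.mem_univ i, ?_⟩
    have := norm_pos_iff.2 (sub_ne_zero.2 hi)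
    positivity
  set L := ‖ν‖ / ‖μ‖
  have hL : 0 ≤ L := by positivity
  have hrep : ∀ c : Quotient (QuotientGroup.rightRel (Subgroup.zpowers γ₀)),
      ∃ γ : Γ, Quotient.mk _ γ = c ∧
        ‖herm (lift1 (act (γ : SU n) z)) (lift1 Y)‖ ≤
          ‖herm (lift1 (act (γ : SU n) z)) (lift1 X)‖ ∧
        ‖herm (lift1 (act (γ : SU n) z)) (lift1 X)‖ ≤
          L * ‖herm (lift1 (act (γ : SU n) z)) (lift1 Y)‖ := by
    intro c
    induction c using Quotient.inductionOn with
    | h γ =>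
      obtain ⟨k, hk⟩ := exists_zpow_act_mem hX hY hμ hν hμν (act_mem (γ : SU n) z.2)
      rw [← act_mul _ _ z.2] at hk
      refine ⟨γ₀ ^ k * γ, Quotient.sound ?_, by simpa using hk⟩
      refine QuotientGroup.rightRel_apply.2 ?_
      rw [mul_inv_rev, mul_inv_cancel_left]
      exact inv_mem (Subgroup.zpow_mem_zpowers γ₀ k)
  choose rep hmk h1 h2 using hrep
  have hinj : Function.Injective rep := Function.LeftInverse.injective hmk
  -- For the chosen representatives the pairing with `X` is at most `L` times that with `Y`, so
  -- `sum_norm_sub_sq_le` bounds the latter, and hence both, below by `c₀`.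
  set c₀ := (∑ i, ‖X i - Y i‖ ^ 2) / (4 * (1 + L)) with hc₀
  have hc₀pos : 0 < c₀ := by positivity
  have hbound : ∀ c, ‖relPoincareTerm (Subgroup.zpowers γ₀) m f hf z c‖ ≤
      ((c₀ * c₀) ^ m)⁻¹ * ‖j (rep c : SU n) z‖ ^ (2 * m) := by
    intro c
    have he : relPoincareTerm (Subgroup.zpowers γ₀) m f hf z c = slash m f (rep c : SU n) z := by
      conv_lhs => rw [← hmk c]
      rfl
    have hy : c₀ ≤ ‖herm (lift1 (act (rep c : SU n) z)) (lift1 Y)‖ := by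
      rw [hc₀, div_le_iff₀ (by positivity)]
      have := sum_norm_sub_sq_le (act_mem (rep c : SU n) z.2) hX hY
      nlinarith [h2 c]
    rw [he, slash, hfXY, norm_mul, norm_div, norm_one, norm_pow, norm_mul, norm_pow, one_div]
    refine mul_le_mul_of_nonneg_right ?_ (by positivity)
    exact inv_anti₀ (by positivity) (pow_le_pow_left₀ (by positivity)
      (mul_le_mul (hy.trans (h1 c)) hy hc₀pos.le (norm_nonneg _)) m)
  exact Summable.of_norm_bounded
    (((summable_norm_j_pow hΓ hm z.2).comp_injective hinj).mul_left _) hbound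

end ComplexHyperbolic

/-! ### Primitive elements of a group with a discrete multiplier -/

theorem exists_minimal_translation {S : Type*} [Group S] (τ : S →* ℝ) (hpos : ∀ s, 0 < τ s)
    (hfin : ∀ R : ℝ, {s : S | 1 ≤ τ s ∧ τ s ≤ R}.Finite) {a : S} (ha : τ a ≠ 1) :
    ∃ δ : S, 1 < τ δ ∧ ∀ s, 1 < τ s → τ δ ≤ τ s := by
  have hinv : ∀ s, τ s⁻¹ = (τ s)⁻¹ := fun s =>
    eq_inv_of_mul_eq_one_left (by rw [← map_mul, inv_mul_cancel, map_one])
  obtain ⟨c, hc⟩ : ∃ c : S, 1 < τ c := by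
    rcases lt_or_gt_of_ne ha with h | h
    · exact ⟨a⁻¹, by rw [hinv]; exact (one_lt_inv₀ (hpos a)).2 h⟩
    · exact ⟨a, h⟩
  have hf : {s : S | 1 < τ s ∧ τ s ≤ τ c}.Finite :=
    (hfin (τ c)).subset fun s hs => ⟨hs.1.le, hs.2⟩
  obtain ⟨δ, hδ, hmin⟩ := hf.exists_minimalFor τ _ ⟨c, hc, le_rfl⟩
  refine ⟨δ, hδ.1, fun s hs => ?_⟩
  rcases le_total (τ s) (τ c) with h | h
  · rcases le_total (τ δ) (τ s) with h' | h'
    · exact h'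
    · exact hmin ⟨hs, h⟩ h'
  · exact hδ.2.trans h

/-- Division with remainder: `τ b / τ δ ^ k` can be brought into `[1, τ δ)`, where minimality leaves
only 1. So `a` is a power of `δ` or `δ⁻¹` times a kernel element, and primitivity makes the exponent
1. -/
theorem translation_of_primitive {S : Type*} [Group S] (τ : S →* ℝ) (hpos : ∀ s, 0 < τ s)
    {δ : S} (hδ : 1 < τ δ) (hmin : ∀ s, 1 < τ s → τ δ ≤ τ s) {a : S}
    (hprim : ∀ (d w : S) (k : ℕ), τ w = 1 → a = d ^ k * w → k = 1) :
    τ a = τ δ ∨ τ a = (τ δ)⁻¹ := by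
  have hinv : ∀ s, τ s⁻¹ = (τ s)⁻¹ := fun s =>
    eq_inv_of_mul_eq_one_left (by rw [← map_mul, inv_mul_cancel, map_one])
  have hdiv : ∀ b : S, 1 ≤ τ b → ∃ k : ℕ, τ b = τ δ ^ k := by
    intro b hb
    obtain ⟨k, hk, hk'⟩ := exists_nat_pow_near hb hδ
    refine ⟨k, ?_⟩
    have hw : τ ((δ ^ k)⁻¹ * b) = τ b / τ δ ^ k := by
      rw [map_mul, hinv, map_pow, inv_mul_eq_div]
    have hkp : 0 < τ δ ^ k := pow_pos (hpos δ) k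
    by_contra hne
    have h1 : 1 < τ ((δ ^ k)⁻¹ * b) := by
      rw [hw, one_lt_div hkp]
      exact lt_of_le_of_ne hk (Ne.symm hne)
    have h2 := hmin _ h1
    rw [hw, le_div_iff₀ hkp, mul_comm, ← pow_succ] at h2
    linarith
  rcases le_total 1 (τ a) with h | h
  · obtain ⟨k, hk⟩ := hdiv a h
    have hk1 := hprim δ ((δ ^ k)⁻¹ * a) k
      (by rw [map_mul, hinv, map_pow, hk, inv_mul_cancel₀ (pow_pos (hpos δ) k).ne'])
      (by group)
    left
    rw [hk, hk1, pow_one]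
  · obtain ⟨k, hk⟩ := hdiv a⁻¹ (by rw [hinv]; exact (one_le_inv₀ (hpos a)).2 h)
    have hk1 := hprim δ⁻¹ ((δ⁻¹ ^ k)⁻¹ * a) k
      (by rw [map_mul, hinv, map_pow, hinv, inv_pow, inv_inv, ← hk, hinv,
            inv_mul_cancel₀ (hpos a).ne'])
      (by group)
    right
    rw [hinv, hk1, pow_one] at hk
    rw [← hk, inv_inv]

/-- Pigeonhole: the elements `a⁻ᴺ bᴺ` all lie in the finite kernel, so two of them coincide;
rearranging gives a common power without any commutativity. -/
theorem exists_pow_eq_pow {S : Type*} [Group S] (τ : S →* ℝ)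
    (hfin : {s : S | τ s = 1}.Finite) {a b : S} (hab : τ a = τ b) :
    ∃ N : ℕ, 0 < N ∧ a ^ N = b ^ N := by
  have hmaps : Set.MapsTo (fun N : ℕ => (a ^ N)⁻¹ * b ^ N) Set.univ {s : S | τ s = 1} := by
    intro N _
    show τ ((a ^ N)⁻¹ * b ^ N) = 1
    rw [map_mul, map_pow, ← hab, ← map_pow, ← map_mul, inv_mul_cancel, map_one]
  obtain ⟨N, -, M, -, hNM, h⟩ :=
    Set.infinite_univ.exists_lt_map_eq_of_mapsTo hmaps hfin
  refine ⟨M - N, Nat.sub_pos_of_lt hNM, ?_⟩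
  rw [pow_sub a hNM.le, pow_sub b hNM.le, eq_mul_inv_iff_mul_eq, mul_assoc]
  exact (congrArg (a ^ M * ·) h).trans (mul_inv_cancel_left _ _)

theorem exists_pow_eq_of_primitive {S : Type*} [Group S] (τ : S →* ℝ) (hpos : ∀ s, 0 < τ s)
    (hfin : ∀ R : ℝ, {s : S | 1 ≤ τ s ∧ τ s ≤ R}.Finite) {a b : S} (ha : τ a ≠ 1)
    (hprim : ∀ (d w : S) (k : ℕ), τ w = 1 → a = d ^ k * w → k = 1)
    (hprim' : ∀ (d w : S) (k : ℕ), τ w = 1 → b = d ^ k * w → k = 1) :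
    ∃ N : ℕ, 0 < N ∧ (a ^ N = b ^ N ∨ a⁻¹ ^ N = b ^ N) := by
  have hinv : ∀ s, τ s⁻¹ = (τ s)⁻¹ := fun s =>
    eq_inv_of_mul_eq_one_left (by rw [← map_mul, inv_mul_cancel, map_one])
  obtain ⟨δ, hδ, hmin⟩ := exists_minimal_translation τ hpos hfin ha
  have h1 := translation_of_primitive τ hpos hδ hmin hprim
  have h2 := translation_of_primitive τ hpos hδ hmin hprim'
  have hker : {s : S | τ s = 1}.Finite :=
    (hfin 1).subset fun s hs => ⟨le_of_eq (Eq.symm hs), le_of_eq hs⟩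
  have key : τ a = τ b ∨ τ a⁻¹ = τ b := by
    rw [hinv]
    rcases h1 with h1 | h1 <;> rcases h2 with h2 | h2 <;> simp [h1, h2]
  rcases key with h | h
  · obtain ⟨N, hN, e⟩ := exists_pow_eq_pow τ hker h
    exact ⟨N, hN, Or.inl e⟩
  · obtain ⟨N, hN, e⟩ := exists_pow_eq_pow τ hker h
    exact ⟨N, hN, Or.inr e⟩

/-! ### Comparing sums over cosets of commensurable cyclic groups -/

theorem relIndex_zpowers_pow {G : Type*} [Group G] {a : G} (ha : ¬IsOfFinOrder a) (N : ℕ) :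
    (Subgroup.zpowers (a ^ N)).relIndex (Subgroup.zpowers a) = N := by
  have hinj : Function.Injective (zpowersHom G a) :=
    injective_zpow_iff_not_isOfFinOrder.2 ha
  have h1 : (Subgroup.zpowers (Multiplicative.ofAdd (N : ℤ))).map (zpowersHom G a) =
      Subgroup.zpowers (a ^ N) := by
    rw [MonoidHom.map_zpowers, zpowersHom_apply, toAdd_ofAdd, zpow_natCast]
  have h2 : (⊤ : Subgroup (Multiplicative ℤ)).map (zpowersHom G a) = Subgroup.zpowers a := by
    ext x
    simp only [Subgroup.mem_map, Subgroup.mem_top, true_and, Subgroup.mem_zpowers_iff,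
      zpowersHom_apply]
    exact ⟨fun ⟨k, hk⟩ => ⟨k.toAdd, hk⟩, fun ⟨k, hk⟩ => ⟨.ofAdd k, hk⟩⟩
  have h3 : Subgroup.zpowers (Multiplicative.ofAdd (N : ℤ)) =
      AddSubgroup.toSubgroup (AddSubgroup.zmultiples (N : ℤ)) := by
    ext x
    simp only [Subgroup.mem_zpowers_iff]
    rfl
  rw [← h1, ← h2, Subgroup.relIndex_map_map_of_injective _ _ hinj, Subgroup.relIndex_top_right, h3,
    AddSubgroup.index_toSubgroup, Int.index_zmultiples, Int.natAbs_natCast]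

/-- As a set, `G ⧸ H` is the product of `G ⧸ K` and the finite set `K ⧸ H`, and the summand ignores
the second factor. -/
theorem tsum_quotient_of_le {G : Type*} [Group G] {H K : Subgroup G} (hHK : H ≤ K)
    (hfin : H.relIndex K ≠ 0) (f : G ⧸ K → ℂ) (hf : Summable f) :
    ∑' c : G ⧸ H, f (Subgroup.quotientMapOfLE hHK c) = H.relIndex K * ∑' c, f c := by
  have : Finite (K ⧸ H.subgroupOf K) := (Nat.finite_of_card_ne_zero hfin)
  have e : ∀ c : G ⧸ H, f (Subgroup.quotientMapOfLE hHK c) =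
      (fun p : (G ⧸ K) × (K ⧸ H.subgroupOf K) => f p.1 * 1)
        (Subgroup.quotientEquivProdOfLE hHK c) := by
    intro c
    rw [Subgroup.quotientEquivProdOfLE_apply]
    simp only [mul_one]
    rfl
  rw [tsum_congr e, (Subgroup.quotientEquivProdOfLE hHK).tsum_eq
    (fun p : (G ⧸ K) × (K ⧸ H.subgroupOf K) => f p.1 * 1), ← tsum_mul_tsum_of_summable_norm hf.norm
    (g := fun _ : K ⧸ H.subgroupOf K => (1 : ℂ)) Summable.of_finite]
  rw [tsum_const, mul_comm, nsmul_eq_mul, mul_one]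
  rfl

/-- Both sums, multiplied by their index, equal one sum over the cosets of the common subgroup. The
exponent is the same on both sides, so the indices agree and cancel. -/
theorem tsum_rightRel_eq {G : Type*} [Group G] {a b : G} (ha : ¬IsOfFinOrder a)
    (hb : ¬IsOfFinOrder b) {N : ℕ} (hN : 0 < N)
    (hab : Subgroup.zpowers (a ^ N) = Subgroup.zpowers (b ^ N)) (F : G → ℂ)
    (f : Quotient (QuotientGroup.rightRel (Subgroup.zpowers a)) → ℂ)
    (f' : Quotient (QuotientGroup.rightRel (Subgroup.zpowers b)) → ℂ)
    (hf : ∀ g, f (Quotient.mk _ g) = F g) (hf' : ∀ g, f' (Quotient.mk _ g) = F g)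
    (hs : Summable f) (hs' : Summable f') : ∑' c, f c = ∑' c, f' c := by
  have hle : Subgroup.zpowers (a ^ N) ≤ Subgroup.zpowers a :=
    Subgroup.zpowers_le.2 (Subgroup.npow_mem_zpowers a N)
  have hle' : Subgroup.zpowers (a ^ N) ≤ Subgroup.zpowers b :=
    hab ▸ Subgroup.zpowers_le.2 (Subgroup.npow_mem_zpowers b N)
  let e := QuotientGroup.quotientRightRelEquivQuotientLeftRel (Subgroup.zpowers a)
  let e' := QuotientGroup.quotientRightRelEquivQuotientLeftRel (Subgroup.zpowers b)
  have hi := relIndex_zpowers_pow ha N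
  have hi' : (Subgroup.zpowers (a ^ N)).relIndex (Subgroup.zpowers b) = N :=
    hab ▸ relIndex_zpowers_pow hb N
  have h1 := tsum_quotient_of_le hle (hi.trans_ne hN.ne') (f ∘ e.symm)
    (e.symm.summable_iff.2 hs)
  have h2 := tsum_quotient_of_le hle' (hi'.trans_ne hN.ne') (f' ∘ e'.symm)
    (e'.symm.summable_iff.2 hs')
  have h12 : ∀ c : G ⧸ Subgroup.zpowers (a ^ N),
      (f ∘ e.symm) (Subgroup.quotientMapOfLE hle c) =
        (f' ∘ e'.symm) (Subgroup.quotientMapOfLE hle' c) := by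
    intro c
    induction c using QuotientGroup.induction_on with
    -- The passage between left and right cosets is inversion.
    | H g => exact (hf g⁻¹).trans (hf' g⁻¹).symm
  rw [tsum_congr h12, h2, hi, hi'] at h1
  have h3 := mul_left_cancel₀ (Nat.cast_ne_zero.2 hN.ne') h1
  have t1 : ∑' c, (f ∘ e.symm) c = ∑' c, f c := e.symm.tsum_eq f
  have t2 : ∑' c, (f' ∘ e'.symm) c = ∑' c, f' c := e'.symm.tsum_eq f'
  rw [← t1, ← t2, h3]

/-! ### Ends of geodesics -/

namespace ComplexHyperbolic

/-- The point `(0, …, 0, x)` of `ℂⁿ`. -/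
noncomputable def axisPoint (n : ℕ) (x : ℝ) : Fin n → ℂ :=
  fun i => if i.val + 1 = n then (x : ℂ) else 0

theorem sum_axisPoint {n : ℕ} (hn : 1 ≤ n) (x : ℝ) : ∑ i, ‖axisPoint n x i‖ ^ 2 = x ^ 2 := by
  have h := sum_last hn fun _ => ((x ^ 2 : ℝ) : ℂ)
  have e : ∀ i : Fin n, (if i.val + 1 = n then ((x ^ 2 : ℝ) : ℂ) else 0) =
      ((‖axisPoint n x i‖ ^ 2 : ℝ) : ℂ) := by
    intro i
    unfold axisPoint
    split_ifs <;> simp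
  simp only [e] at h
  exact_mod_cast h

theorem herm_axisPoint {n : ℕ} (hn : 1 ≤ n) {x : ℝ} (hx : x ^ 2 = 1) :
    herm (lift1 (axisPoint n x)) (lift1 (axisPoint n x)) = 0 := by
  have := sum_axisPoint hn x
  rw [herm_self]
  simp [lift1, this, hx]

theorem axisPoint_mem {n : ℕ} (hn : 1 ≤ n) {x : ℝ} (hx : x ∈ Set.Ioo (-1) 1) :
    axisPoint n x ∈ unitBall n := by
  show ∑ i, ‖axisPoint n x i‖ ^ 2 < 1
  rw [sum_axisPoint hn]
  nlinarith [hx.1, hx.2]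

theorem mem_stdGeodesic_iff {n : ℕ} {z : Fin n → ℂ} :
    z ∈ stdGeodesic n ↔ ∃ x ∈ Set.Ioo (-1 : ℝ) 1, z = axisPoint n x := by
  constructor
  · rintro ⟨t, rfl⟩
    exact ⟨Real.tanh t, ⟨Real.neg_one_lt_tanh t, Real.tanh_lt_one t⟩, rfl⟩
  · rintro ⟨x, hx, rfl⟩
    exact ⟨Real.artanh x, by rw [Real.tanh_artanh hx]; rfl⟩

theorem last_ne_zero_of_null {n : ℕ} {V : Idx n → ℂ} (hV : herm V V = 0) (h0 : V ≠ 0) :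
    V (Sum.inr ()) ≠ 0 := by
  intro h
  apply h0
  rw [herm_self, Complex.ofReal_eq_zero, h] at hV
  simp only [norm_zero, ne_eq, OfNat.ofNat_ne_zero, not_false_eq_true, zero_pow, sub_zero] at hV
  rw [Finset.sum_eq_zero_iff_of_nonneg fun _ _ => sq_nonneg _] at hV
  funext i
  rcases i with i | i
  · simpa using hV i (Finset.mem_univ i)
  · exact h

theorem lift1_ne_zero {n : ℕ} (z : Fin n → ℂ) : lift1 z ≠ 0 := fun h => by
  simpa [lift1] using congrFun h (Sum.inr ())

theorem mulVec_ne_zero {n : ℕ} (g : SU n) {Z : Idx n → ℂ} (hZ : Z ≠ 0) :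
    (mat g).mulVec Z ≠ 0 := fun h => hZ <| by
  rw [← mat_inv_mulVec g Z, h, Matrix.mulVec_zero]

theorem denom_ne_zero_of_null {n : ℕ} (g : SU n) {z : Fin n → ℂ}
    (hz : herm (lift1 z) (lift1 z) = 0) : (mat g).mulVec (lift1 z) (Sum.inr ()) ≠ 0 :=
  last_ne_zero_of_null (by rw [herm_mat, hz]) (mulVec_ne_zero g (lift1_ne_zero z))

theorem lift1_act_of_null {n : ℕ} (g : SU n) {z : Fin n → ℂ}
    (hz : herm (lift1 z) (lift1 z) = 0) :
    (mat g).mulVec (lift1 z) = (mat g).mulVec (lift1 z) (Sum.inr ()) • lift1 (act g z) := by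
  have h := denom_ne_zero_of_null g hz
  funext i
  rcases i with i | i
  · simp only [lift1, act, Pi.smul_apply, Sum.elim_inl, smul_eq_mul]
    exact (mul_div_cancel₀ _ h).symm
  · simp [lift1]

theorem herm_act_of_null {n : ℕ} (g : SU n) {z : Fin n → ℂ}
    (hz : herm (lift1 z) (lift1 z) = 0) : herm (lift1 (act g z)) (lift1 (act g z)) = 0 := by
  have h := herm_mat g (lift1 z) (lift1 z)
  have h0 := denom_ne_zero_of_null g hz
  rw [lift1_act_of_null g hz, herm_smul_smul, hz] at h
  exact (mul_eq_zero.1 h).resolve_left (mul_ne_zero h0 (star_ne_zero.2 h0))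

/-- An element preserving the standard geodesic permutes its two ends. -/
theorem act_axisPoint_of_mapsTo {n : ℕ} (hn : 1 ≤ n) {g : SU n}
    (hg : ∀ z ∈ stdGeodesic n, act g z ∈ stdGeodesic n) {x : ℝ} (hx : x ^ 2 = 1) :
    ∃ y : ℝ, y ^ 2 = 1 ∧ act g (axisPoint n x) = axisPoint n y := by
  let Z : ℝ → Idx n → ℂ := fun x => (mat g).mulVec (lift1 (axisPoint n x))
  have hZc : ∀ k, Continuous fun x => Z x k := by
    intro k
    have hc : Continuous fun x : ℝ => lift1 (axisPoint n x) := by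
      refine continuous_pi fun i => ?_
      rcases i with i | i
      · simp only [lift1, Sum.elim_inl, axisPoint]
        split_ifs <;> fun_prop
      · simp only [lift1, Sum.elim_inr]
        fun_prop
    exact (continuous_apply k).comp (continuous_const.matrix_mulVec hc)
  -- Being carried to the real line in the last coordinate, written in homogeneous coordinates so as
  -- to be a closed condition; it passes from the open interval to its ends `±1`.
  let T : Set ℝ := ⋂ i : Fin n, {x | (i.val + 1 ≠ n → Z x (Sum.inl i) = 0) ∧
    (Z x (Sum.inl i) * star (Z x (Sum.inr ()))).im = 0}
  have hT : IsClosed T := by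
    refine isClosed_iInter fun i => ?_
    have h1 : IsClosed {x | i.val + 1 ≠ n → Z x (Sum.inl i) = 0} := by
      by_cases hi : i.val + 1 ≠ n
      · simpa only [hi, ne_eq, not_false_eq_true, forall_true_left] using
          isClosed_eq (hZc (Sum.inl i)) continuous_const
      · simp [hi]
    exact h1.inter (isClosed_eq
      (Complex.continuous_im.comp ((hZc _).mul (continuous_star.comp (hZc _)))) continuous_const)
  have hsub : Set.Ioo (-1) 1 ⊆ T := by
    intro x hx
    obtain ⟨y, -, hy⟩ := mem_stdGeodesic_iff.1 (hg _ (mem_stdGeodesic_iff.2 ⟨x, hx, rfl⟩))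
    have e := lift1_act g (axisPoint_mem hn hx)
    rw [hy] at e
    refine Set.mem_iInter.2 fun i => ?_
    have ei : Z x (Sum.inl i) = Z x (Sum.inr ()) * axisPoint n y i := congrFun e (Sum.inl i)
    refine ⟨fun hi => by simp [ei, axisPoint, hi], ?_⟩
    rw [ei, mul_right_comm, Complex.star_def, Complex.mul_conj]
    unfold axisPoint
    split_ifs
    · rw [← Complex.ofReal_mul, Complex.ofReal_im]
    · simp
  have hxT : x ∈ T := by
    refine closure_minimal hsub hT ?_
    rw [closure_Ioo (by norm_num)]
    exact ⟨by nlinarith, by nlinarith⟩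
  have hnull := herm_axisPoint hn hx
  have hd : Z x (Sum.inr ()) ≠ 0 := denom_ne_zero_of_null g hnull
  have hnull' := herm_act_of_null g hnull
  set l : Fin n := ⟨n - 1, by omega⟩ with hl
  have hl' : l.val + 1 = n := by simp [hl]; omega
  have hU : ∀ i, act g (axisPoint n x) i = Z x (Sum.inl i) / Z x (Sum.inr ()) := fun _ => rfl
  have him : (act g (axisPoint n x) l).im = 0 := by
    have h := (Set.mem_iInter.1 hxT l).2
    have e : act g (axisPoint n x) l * ((Complex.normSq (Z x (Sum.inr ())) : ℝ) : ℂ) =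
        Z x (Sum.inl l) * star (Z x (Sum.inr ())) := by
      rw [hU, ← Complex.mul_conj, Complex.star_def]
      field_simp
    rw [← e, Complex.im_mul_ofReal] at h
    exact (mul_eq_zero.1 h).resolve_right (fun h => hd (Complex.normSq_eq_zero.1 h))
  have heq : act g (axisPoint n x) = axisPoint n (act g (axisPoint n x) l).re := by
    funext i
    unfold axisPoint
    split_ifs with hi
    · have : i = l := Fin.ext (by omega)
      rw [this]
      exact Complex.ext rfl him
    · have h := (Set.mem_iInter.1 hxT i).1 hi
      change act g (axisPoint n x) i = 0
      rw [hU, h, zero_div]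
  refine ⟨_, ?_, heq⟩
  rw [heq, herm_self, Complex.ofReal_eq_zero] at hnull'
  have := sum_axisPoint hn (act g (axisPoint n x) l).re
  simp only [lift1, Sum.elim_inl, Sum.elim_inr, norm_one] at hnull'
  linarith

theorem act_mul_of_null {n : ℕ} (g h : SU n) {z : Fin n → ℂ}
    (hz : herm (lift1 z) (lift1 z) = 0) : act (g * h) z = act g (act h z) := by
  have e : (mat (g * h)).mulVec (lift1 z) =
      (mat h).mulVec (lift1 z) (Sum.inr ()) • (mat g).mulVec (lift1 (act h z)) := by
    rw [mat_mul, ← Matrix.mulVec_mulVec]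
    conv_lhs => rw [lift1_act_of_null h hz]
    rw [Matrix.mulVec_smul]
  funext i
  simp only [act]
  rw [e]
  simp only [Pi.smul_apply, smul_eq_mul]
  rw [mul_div_mul_left _ _ (denom_ne_zero_of_null h hz)]

theorem act_one {n : ℕ} (z : Fin n → ℂ) : act (1 : SU n) z = z := by
  funext i
  have h : mat (1 : SU n) = 1 := rfl
  simp [act, h, lift1]


theorem act_injOn_null {n : ℕ} (g : SU n) {z w : Fin n → ℂ}
    (hz : herm (lift1 z) (lift1 z) = 0) (hw : herm (lift1 w) (lift1 w) = 0)
    (h : act g z = act g w) : z = w := by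
  rw [← act_one z, ← act_one w, ← inv_mul_cancel g, act_mul_of_null _ _ hz,
    act_mul_of_null _ _ hw, h]

theorem axisPoint_injective {n : ℕ} (hn : 1 ≤ n) {x y : ℝ} (h : axisPoint n x = axisPoint n y) :
    x = y := by
  have e := congrFun h ⟨n - 1, by omega⟩
  simpa [axisPoint, Nat.sub_add_cancel hn] using e

/-- A permutation of two ends has trivial square; passing to the square avoids having to exclude a
swap. -/
theorem act_sq_axisPoint {n : ℕ} (hn : 1 ≤ n) {g : SU n}
    (hg : ∀ z ∈ stdGeodesic n, act g z ∈ stdGeodesic n) {x : ℝ} (hx : x ^ 2 = 1) :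
    act (g ^ 2) (axisPoint n x) = axisPoint n x := by
  have hx' : (-x) ^ 2 = 1 := by rw [neg_sq, hx]
  have hx0 : x ≠ -x := fun h => by nlinarith
  have hn1 := herm_axisPoint hn hx
  have hn2 := herm_axisPoint hn hx'
  obtain ⟨y, hy, e⟩ := act_axisPoint_of_mapsTo hn hg hx
  obtain ⟨y', hy', e'⟩ := act_axisPoint_of_mapsTo hn hg hx'
  rw [pow_two, act_mul_of_null _ _ hn1, e]
  rcases sq_eq_sq_iff_eq_or_eq_neg.1 (hy.trans hx.symm) with rfl | rfl
  · exact e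
  · rcases sq_eq_sq_iff_eq_or_eq_neg.1 (hy'.trans hx.symm) with rfl | rfl
    · exact e'
    · exact absurd (axisPoint_injective hn (act_injOn_null g hn1 hn2 (e.trans e'.symm))) hx0

/-- If `|c| ≥ 1` then `|c||ν| > 1`, which makes `U` orthogonal to `Y`; orthogonal null vectors of
this normalization coincide. -/
theorem eq_end_of_eigen {n : ℕ} {g : SU n} {X Y U : Fin n → ℂ}
    (hX : herm (lift1 X) (lift1 X) = 0) (hY : herm (lift1 Y) (lift1 Y) = 0)
    (hU : herm (lift1 U) (lift1 U) = 0) {μ ν c : ℂ}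
    (hμ : (mat g).mulVec (lift1 X) = μ • lift1 X) (hν : (mat g).mulVec (lift1 Y) = ν • lift1 Y)
    (hc : (mat g).mulVec (lift1 U) = c • lift1 U) (hμ1 : ‖μ‖ < 1) (hν1 : 1 < ‖ν‖) :
    U = X ∨ U = Y := by
  rcases lt_or_ge ‖c‖ 1 with h | h
  · exact Or.inl (IsRepelling.unique ⟨hU, c, h, hc⟩ ⟨hX, μ, hμ1, hμ⟩)
  · refine Or.inr (eq_of_null hU hY (herm_eq_zero_of_eigen g hc hν (ne_of_gt ?_)))
    nlinarith

/-- The ends of a geodesic preserved by `g` are the two fixed points of `g`. -/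
theorem ends_of_mapsTo {n : ℕ} (hn : 1 ≤ n) {g h : SU n}
    (hg : act g '' (act h '' stdGeodesic n) = act h '' stdGeodesic n) {X Y : Fin n → ℂ}
    (hX : IsRepelling g X) (hY : IsAttracting g Y) :
    (act h (axisPoint n 1) = X ∧ act h (axisPoint n (-1)) = Y) ∨
      (act h (axisPoint n 1) = Y ∧ act h (axisPoint n (-1)) = X) := by
  obtain ⟨hX0, μ, hμ1, hμ⟩ := hX
  obtain ⟨hY0, ν, hν1, hν⟩ := hY
  have hball : ∀ z ∈ stdGeodesic n, z ∈ unitBall n := fun z hz => by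
    obtain ⟨x, hx, rfl⟩ := mem_stdGeodesic_iff.1 hz
    exact axisPoint_mem hn hx
  have hstd : ∀ z ∈ stdGeodesic n, act (h⁻¹ * (g * h)) z ∈ stdGeodesic n := by
    intro z hz
    have hzb := hball z hz
    obtain ⟨w, hw, e⟩ : act g (act h z) ∈ act h '' stdGeodesic n :=
      hg ▸ Set.mem_image_of_mem _ (Set.mem_image_of_mem _ hz)
    rw [act_mul _ _ hzb, act_mul _ _ hzb, ← e, ← act_mul _ _ (hball w hw), inv_mul_cancel, act_one]
    exact hw
  have hend : ∀ x : ℝ, x ^ 2 = 1 → act h (axisPoint n x) = X ∨ act h (axisPoint n x) = Y := by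
    intro x hx
    have hx0 := herm_axisPoint hn hx
    have hU0 := herm_act_of_null h hx0
    -- Conjugation by `h` reduces to the standard geodesic. The fixed end is then a null eigenvector
    -- of `g²`, which has the same contracting and expanding directions as `g`.
    have hfix : act (g ^ 2) (act h (axisPoint n x)) = act h (axisPoint n x) := by
      rw [← act_mul_of_null _ _ hx0, show g ^ 2 * h = h * (h⁻¹ * (g * h)) ^ 2 by
        rw [pow_two, pow_two]; group, act_mul_of_null _ _ hx0, act_sq_axisPoint hn hstd hx]
    have hc := lift1_act_of_null (g ^ 2) hU0
    rw [hfix] at hc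
    refine eq_end_of_eigen hX0 hY0 hU0 (eigen_pow hμ 2) (eigen_pow hν 2) hc ?_ ?_
    · rw [norm_pow]; exact pow_lt_one₀ (norm_nonneg _) hμ1 two_ne_zero
    · rw [norm_pow]; exact one_lt_pow₀ hν1 two_ne_zero
  have hne : act h (axisPoint n 1) ≠ act h (axisPoint n (-1)) := fun e => by
    have := axisPoint_injective hn (act_injOn_null h (herm_axisPoint hn (by norm_num))
      (herm_axisPoint hn (by norm_num)) e)
    norm_num at this
  rcases hend 1 (by norm_num) with h1 | h1 <;> rcases hend (-1) (by norm_num) with h2 | h2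
  · exact absurd (h1.trans h2.symm) hne
  · exact Or.inl ⟨h1, h2⟩
  · exact Or.inr ⟨h1, h2⟩
  · exact absurd (h1.trans h2.symm) hne

theorem lift1_mem_span_ends {n : ℕ} (hn : 1 ≤ n) (h : SU n) {z : Fin n → ℂ}
    (hz : z ∈ act h '' stdGeodesic n) :
    ∃ a b : ℂ, lift1 z =
      a • lift1 (act h (axisPoint n 1)) + b • lift1 (act h (axisPoint n (-1))) := by
  obtain ⟨w, hw, rfl⟩ := hz
  obtain ⟨x, hx, rfl⟩ := mem_stdGeodesic_iff.1 hw
  have hxb := axisPoint_mem hn hx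
  have e : lift1 (axisPoint n x) = ((1 + x) / 2 : ℂ) • lift1 (axisPoint n 1) +
      ((1 - x) / 2 : ℂ) • lift1 (axisPoint n (-1)) := by
    funext i
    rcases i with i | i
    · simp only [lift1, axisPoint, Sum.elim_inl, Pi.add_apply, Pi.smul_apply, smul_eq_mul]
      split_ifs
      · push_cast; ring
      · ring
    · simp only [lift1, Sum.elim_inr, Pi.add_apply, Pi.smul_apply, smul_eq_mul]
      ring
  have h1 := lift1_act_of_null h (herm_axisPoint hn (x := 1) (by norm_num))
  have h2 := lift1_act_of_null h (herm_axisPoint hn (x := -1) (by norm_num))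
  have hd := denom_ne_zero h hxb
  have e2 := lift1_act h hxb
  have e3 : lift1 (act h (axisPoint n x)) =
      ((mat h).mulVec (lift1 (axisPoint n x)) (Sum.inr ()))⁻¹ •
        (mat h).mulVec (lift1 (axisPoint n x)) := by
    rw [eq_inv_smul_iff₀ hd]
    exact e2.symm
  generalize ((mat h).mulVec (lift1 (axisPoint n x)) (Sum.inr ()))⁻¹ = D at e3
  rw [e, Matrix.mulVec_add, Matrix.mulVec_smul, Matrix.mulVec_smul, h1, h2, smul_add, smul_smul,
    smul_smul, smul_smul, smul_smul] at e3
  exact ⟨_, _, e3⟩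

/-! ### The stabilizer of two boundary points -/

theorem herm_ends_ne_zero {n : ℕ} {X Y : Fin n → ℂ} (hX : herm (lift1 X) (lift1 X) = 0)
    (hY : herm (lift1 Y) (lift1 Y) = 0) (hXY : X ≠ Y) : herm (lift1 X) (lift1 Y) ≠ 0 :=
  fun h => hXY (eq_of_null hX hY h)

theorem mul_star_eigen {n : ℕ} {g : SU n} {X Y : Fin n → ℂ}
    (hX : herm (lift1 X) (lift1 X) = 0) (hY : herm (lift1 Y) (lift1 Y) = 0) (hXY : X ≠ Y) {μ ν : ℂ}
    (hμ : (mat g).mulVec (lift1 X) = μ • lift1 X) (hν : (mat g).mulVec (lift1 Y) = ν • lift1 Y) :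
    μ * star ν = 1 := by
  have e := herm_mat g (lift1 X) (lift1 Y)
  rw [hμ, hν, herm_smul_smul] at e
  exact mul_right_cancel₀ (herm_ends_ne_zero hX hY hXY) (by rw [e, one_mul])

/-- From `μ ν̄ = 1` and `|μ| = 1` follows `μ = ν`, so `g` is a scalar on the plane spanned by the
two ends. -/
theorem act_eq_of_mem_span {n : ℕ} {g : SU n} {X Y : Fin n → ℂ}
    (hX : herm (lift1 X) (lift1 X) = 0) (hY : herm (lift1 Y) (lift1 Y) = 0) (hXY : X ≠ Y) {μ ν : ℂ}
    (hμ : (mat g).mulVec (lift1 X) = μ • lift1 X) (hν : (mat g).mulVec (lift1 Y) = ν • lift1 Y)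
    (h1 : ‖μ‖ = 1) {z : Fin n → ℂ} {a b : ℂ} (hz : lift1 z = a • lift1 X + b • lift1 Y) :
    act g z = z := by
  have e := mul_star_eigen hX hY hXY hμ hν
  have hν1 : ‖ν‖ = 1 := by
    have := congrArg norm e
    rwa [norm_mul, norm_star, h1, one_mul, norm_one] at this
  have hμν : μ = ν := by
    have h2 : ν * star ν = 1 := by
      rw [Complex.star_def, Complex.mul_conj, Complex.normSq_eq_norm_sq, hν1]
      simp
    exact mul_right_cancel₀ (right_ne_zero_of_mul_eq_one e) (e.trans h2.symm)
  subst hμν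
  have e2 : (mat g).mulVec (lift1 z) = μ • lift1 z := by
    rw [hz, Matrix.mulVec_add, Matrix.mulVec_smul, Matrix.mulVec_smul, hμ, hν, smul_add,
      smul_comm a, smul_comm b]
  have hμ0 : μ ≠ 0 := eigen_ne_zero hμ
  funext i
  simp only [act, e2]
  simp [lift1, hμ0]

/-- The sum of the lifts of two distinct boundary points is a negative vector with last coordinate
2, and `norm_mulVec_last` applied to it recovers `|d|` from the two eigenvalues. -/
theorem norm_lastEntry_le_of_ends {n : ℕ} {X Y : Fin n → ℂ}
    (hX : herm (lift1 X) (lift1 X) = 0) (hY : herm (lift1 Y) (lift1 Y) = 0) (hXY : X ≠ Y) :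
    ∃ C : ℝ, 0 ≤ C ∧ ∀ (g : SU n) (μ ν : ℂ), (mat g).mulVec (lift1 X) = μ • lift1 X →
      (mat g).mulVec (lift1 Y) = ν • lift1 Y → ‖lastEntry g‖ ≤ C * (‖μ‖ + ‖ν‖) := by
  have hsum : ∑ i, ‖X i + Y i‖ ^ 2 < 2 ^ 2 := by
    have hpar : ∑ i, ‖X i + Y i‖ ^ 2 + ∑ i, ‖X i - Y i‖ ^ 2 =
        2 * ∑ i, ‖X i‖ ^ 2 + 2 * ∑ i, ‖Y i‖ ^ 2 := by
      rw [← Finset.sum_add_distrib, Finset.mul_sum, Finset.mul_sum, ← Finset.sum_add_distrib]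
      refine Finset.sum_congr rfl fun i _ => ?_
      have := parallelogram_law_with_norm ℝ (X i) (Y i)
      nlinarith
    have hdist : 0 < ∑ i, ‖X i - Y i‖ ^ 2 := by
      obtain ⟨i, hi⟩ := Function.ne_iff.1 hXY
      refine Finset.sum_pos' (fun _ _ => sq_nonneg _) ⟨i, Finset.mem_univ i, ?_⟩
      have := norm_pos_iff.2 (sub_ne_zero.2 hi)
      positivity
    rw [herm_self, Complex.ofReal_eq_zero] at hX hY
    simp only [lift1, Sum.elim_inl, Sum.elim_inr, norm_one] at hX hY
    linarith
  have hs : 0 ≤ ∑ i, ‖X i + Y i‖ ^ 2 := Finset.sum_nonneg fun _ _ => sq_nonneg _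
  set a := √(∑ i, ‖X i + Y i‖ ^ 2) with ha
  have ha2 : a < 2 := by rwa [ha, Real.sqrt_lt' two_pos]
  refine ⟨(2 - a)⁻¹, inv_nonneg.2 (by linarith), fun g μ ν hμ hν => ?_⟩
  have h := (norm_mulVec_last g (lift1 X + lift1 Y) (Real.sqrt_nonneg _) (Real.sq_sqrt hs).ge).1
  rw [Matrix.mulVec_add, hμ, hν] at h
  simp only [lift1, Pi.add_apply, Pi.smul_apply, Sum.elim_inr, smul_eq_mul, mul_one] at h
  rw [one_add_one_eq_two, Complex.norm_ofNat, ← ha] at h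
  rw [inv_mul_eq_div, le_div_iff₀ (by linarith)]
  exact h.trans (norm_add_le _ _)


/-- The elements of `Γ` which fix the boundary points `X` and `Y`. -/
def endStabilizer {n : ℕ} (Γ : Subgroup (SU n)) (X Y : Fin n → ℂ) : Subgroup Γ where
  carrier := {γ | (∃ μ : ℂ, (mat (γ : SU n)).mulVec (lift1 X) = μ • lift1 X) ∧
    ∃ ν : ℂ, (mat (γ : SU n)).mulVec (lift1 Y) = ν • lift1 Y}
  mul_mem' := fun ⟨⟨_, h1⟩, ⟨_, h2⟩⟩ ⟨⟨_, h1'⟩, ⟨_, h2'⟩⟩ =>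
    ⟨⟨_, eigen_mul h1 h1'⟩, ⟨_, eigen_mul h2 h2'⟩⟩
  one_mem' := ⟨⟨1, by rw [one_smul]; exact Matrix.one_mulVec _⟩,
    ⟨1, by rw [one_smul]; exact Matrix.one_mulVec _⟩⟩
  inv_mem' := fun ⟨⟨_, h1⟩, ⟨_, h2⟩⟩ =>
    ⟨⟨_, eigen_inv (eigen_ne_zero h1) h1⟩, ⟨_, eigen_inv (eigen_ne_zero h2) h2⟩⟩

theorem eigenvalue_eq {n : ℕ} {g : SU n} {X : Fin n → ℂ} {μ : ℂ}
    (h : (mat g).mulVec (lift1 X) = μ • lift1 X) :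
    (mat g).mulVec (lift1 X) (Sum.inr ()) = μ := by
  rw [h]
  simp [lift1]

/-- The absolute value of the eigenvalue of `(X, 1)`. -/
noncomputable def endMultiplier {n : ℕ} (Γ : Subgroup (SU n)) (X Y : Fin n → ℂ) :
    endStabilizer Γ X Y →* ℝ where
  toFun s := ‖(mat ((s : Γ) : SU n)).mulVec (lift1 X) (Sum.inr ())‖
  map_one' := by
    have : (mat (1 : SU n)).mulVec (lift1 X) = lift1 X := Matrix.one_mulVec _
    change ‖(mat (1 : SU n)).mulVec (lift1 X) (Sum.inr ())‖ = 1
    rw [this]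
    simp [lift1]
  map_mul' := by
    rintro ⟨s, ⟨μ, h1⟩, h2⟩ ⟨t, ⟨ν, h1'⟩, h2'⟩
    change ‖(mat ((s : SU n) * (t : SU n))).mulVec (lift1 X) (Sum.inr ())‖ =
      ‖(mat (s : SU n)).mulVec (lift1 X) (Sum.inr ())‖ *
        ‖(mat (t : SU n)).mulVec (lift1 X) (Sum.inr ())‖
    rw [eigenvalue_eq h1, eigenvalue_eq h1', eigenvalue_eq (eigen_mul h1 h1'), norm_mul]

theorem endMultiplier_apply {n : ℕ} {Γ : Subgroup (SU n)} {X Y : Fin n → ℂ}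
    (s : endStabilizer Γ X Y) {μ : ℂ}
    (h : (mat ((s : Γ) : SU n)).mulVec (lift1 X) = μ • lift1 X) :
    endMultiplier Γ X Y s = ‖μ‖ :=
  congrArg norm (eigenvalue_eq h)

theorem endMultiplier_pos {n : ℕ} {Γ : Subgroup (SU n)} {X Y : Fin n → ℂ}
    (s : endStabilizer Γ X Y) : 0 < endMultiplier Γ X Y s := by
  obtain ⟨μ, h⟩ := s.2.1
  rw [endMultiplier_apply s h]
  exact norm_pos_iff.2 (eigen_ne_zero h)

/-- The eigenvalues at the two ends have reciprocal absolute values, so a multiplier in `[1, R]`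
bounds both, hence the last entry. -/
theorem finite_endMultiplier_le {n : ℕ} {Γ : Subgroup (SU n)} (hΓ : DiscreteTopology Γ)
    {X Y : Fin n → ℂ} (hX : herm (lift1 X) (lift1 X) = 0) (hY : herm (lift1 Y) (lift1 Y) = 0)
    (hXY : X ≠ Y) (R : ℝ) :
    {s | 1 ≤ endMultiplier Γ X Y s ∧ endMultiplier Γ X Y s ≤ R}.Finite := by
  obtain ⟨C, hC, h⟩ := norm_lastEntry_le_of_ends hX hY hXY
  refine Set.Finite.subset ((finite_norm_lastEntry_le hΓ (C * (R + 1))).preimage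
    Subtype.val_injective.injOn) ?_
  rintro s ⟨h1, h2⟩
  obtain ⟨⟨μ, hμ⟩, ν, hν⟩ := s.2
  rw [endMultiplier_apply s hμ] at h1 h2
  have e := congrArg norm (mul_star_eigen hX hY hXY hμ hν)
  rw [norm_mul, norm_star, norm_one] at e
  refine (h _ μ ν hμ hν).trans (mul_le_mul_of_nonneg_left (add_le_add h2 ?_) hC)
  nlinarith [norm_nonneg ν]

theorem not_isOfFinOrder_of_eigen {n : ℕ} {Γ : Subgroup (SU n)} {γ : Γ} {X : Fin n → ℂ} {μ : ℂ}
    (h : (mat (γ : SU n)).mulVec (lift1 X) = μ • lift1 X) (hμ : ‖μ‖ < 1) :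
    ¬IsOfFinOrder γ := by
  rw [isOfFinOrder_iff_pow_eq_one]
  rintro ⟨k, hk, e⟩
  have h1 := eigenvalue_eq (eigen_pow h k)
  have h2 : (γ : SU n) ^ k = 1 := by
    rw [← Subgroup.coe_pow, e, Subgroup.coe_one]
  have h3 : (mat (1 : SU n)).mulVec (lift1 X) = lift1 X := Matrix.one_mulVec _
  rw [h2, h3] at h1
  have h4 := congrArg norm h1
  rw [norm_pow] at h4
  simp only [lift1, Sum.elim_inr, norm_one] at h4
  exact (pow_lt_one₀ (norm_nonneg _) hμ hk.ne').ne h4.symm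

/-! ### Application to loxodromic elements with a common axis -/

theorem isRepelling_repellingPoint {n : ℕ} (hn : 1 ≤ n) {g : SU n} (hg : IsLoxodromic g) :
    IsRepelling g (repellingPoint g) :=
  Classical.epsilon_spec (hg.existsUnique_ends hn).1.exists

theorem isAttracting_attractingPoint {n : ℕ} (hn : 1 ≤ n) {g : SU n} (hg : IsLoxodromic g) :
    IsAttracting g (attractingPoint g) :=
  Classical.epsilon_spec (hg.existsUnique_ends hn).2.exists

theorem succ_le_weight {n : ℕ} {κ : ℚ} (hκ : κ ∈ admissible n) : n + 1 ≤ weight n κ := by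
  have h := weight_cast hκ
  have h1 : (1 : ℚ) ≤ κ := hκ.1
  have : ((n + 1 : ℕ) : ℚ) ≤ (weight n κ : ℚ) := by
    rw [h]
    push_cast
    nlinarith [(Nat.cast_nonneg n : (0 : ℚ) ≤ n)]
  exact_mod_cast this

theorem summable_thetaTerm {n : ℕ} (hn : 1 ≤ n) {Γ : Subgroup (SU n)} (hΓ : DiscreteTopology Γ)
    {κ : ℚ} (hκ : κ ∈ admissible n) {γ₀ : Γ} (hlox : IsLoxodromic (γ₀ : SU n))
    (h : HasTheta γ₀ κ) (z : unitBall n) : Summable (thetaTerm γ₀ κ h z) := by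
  obtain ⟨hX, μ, hμ1, hμ⟩ := isRepelling_repellingPoint hn hlox
  obtain ⟨hY, ν, hν1, hν⟩ := isAttracting_attractingPoint hn hlox
  exact summable_relPoincareTerm hΓ γ₀ hX hY hμ hν (hμ1.trans hν1) (succ_le_weight hκ)
    (fun _ => rfl) h z

/-- Both pairs of fixed points are the ends of `C`, perhaps in opposite order, and the product does
not see the order. -/
theorem Q_eq_of_axis {n : ℕ} (hn : 1 ≤ n) {g g' : SU n} (hg : IsLoxodromic g)
    (hg' : IsLoxodromic g') {C : Set (Fin n → ℂ)} (hC : IsAxis g C) (hC' : IsAxis g' C) :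
    Q g = Q g' := by
  obtain ⟨⟨h, rfl⟩, hgC⟩ := hC
  funext z
  unfold Q
  rcases ends_of_mapsTo hn hgC (isRepelling_repellingPoint hn hg)
    (isAttracting_attractingPoint hn hg) with ⟨h1, h2⟩ | ⟨h1, h2⟩ <;>
  rcases ends_of_mapsTo hn hC'.2 (isRepelling_repellingPoint hn hg')
    (isAttracting_attractingPoint hn hg') with ⟨h3, h4⟩ | ⟨h3, h4⟩ <;>
  rw [← h1, ← h2, ← h3, ← h4] <;> ring

theorem lift1_mem_span_of_axis {n : ℕ} (hn : 1 ≤ n) {g : SU n} (hg : IsLoxodromic g)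
    {C : Set (Fin n → ℂ)} (hC : IsAxis g C) {z : Fin n → ℂ} (hz : z ∈ C) :
    ∃ a b : ℂ, lift1 z = a • lift1 (repellingPoint g) + b • lift1 (attractingPoint g) := by
  obtain ⟨⟨h, rfl⟩, hgC⟩ := hC
  obtain ⟨a, b, e⟩ := lift1_mem_span_ends hn h hz
  rcases ends_of_mapsTo hn hgC (isRepelling_repellingPoint hn hg)
    (isAttracting_attractingPoint hn hg) with ⟨h1, h2⟩ | ⟨h1, h2⟩
  · exact ⟨a, b, by rw [← h1, ← h2, e]⟩
  · exact ⟨b, a, by rw [← h1, ← h2, e, add_comm]⟩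

theorem mem_endStabilizer_of_axis {n : ℕ} (hn : 1 ≤ n) {Γ : Subgroup (SU n)} {γ₀ γ₁ : Γ}
    (hlox₀ : IsLoxodromic (γ₀ : SU n)) (hlox₁ : IsLoxodromic (γ₁ : SU n))
    {C : Set (Fin n → ℂ)} (hC : IsAxis (γ₀ : SU n) C) (hC' : IsAxis (γ₁ : SU n) C) :
    γ₁ ∈ endStabilizer Γ (repellingPoint (γ₀ : SU n)) (attractingPoint (γ₀ : SU n)) := by
  obtain ⟨⟨h, rfl⟩, hgC⟩ := hC
  have hR := isRepelling_repellingPoint hn hlox₁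
  have hA := isAttracting_attractingPoint hn hlox₁
  obtain ⟨-, μ, -, hμ⟩ := id hR
  obtain ⟨-, ν, -, hν⟩ := id hA
  rcases ends_of_mapsTo hn hgC (isRepelling_repellingPoint hn hlox₀)
    (isAttracting_attractingPoint hn hlox₀) with ⟨h1, h2⟩ | ⟨h1, h2⟩ <;>
  rcases ends_of_mapsTo hn hC'.2 hR hA with ⟨h3, h4⟩ | ⟨h3, h4⟩ <;>
  rw [← h1, ← h2, h3, h4]
  · exact ⟨⟨μ, hμ⟩, ν, hν⟩
  · exact ⟨⟨ν, hν⟩, μ, hμ⟩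
  · exact ⟨⟨ν, hν⟩, μ, hμ⟩
  · exact ⟨⟨μ, hμ⟩, ν, hν⟩

/-- Primitive elements with the same axis have a common power up to inversion. -/
theorem exists_zpowers_pow_eq {n : ℕ} (hn : 1 ≤ n) {Γ : Subgroup (SU n)}
    (hΓ : DiscreteTopology Γ) {γ₀ γ₁ : Γ} (hlox₀ : IsLoxodromic (γ₀ : SU n))
    (hlox₁ : IsLoxodromic (γ₁ : SU n)) (hprim₀ : IsPrimitive γ₀) (hprim₁ : IsPrimitive γ₁)
    {C : Set (Fin n → ℂ)} (hC : IsAxis (γ₀ : SU n) C) (hC' : IsAxis (γ₁ : SU n) C) :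
    ∃ N : ℕ, 0 < N ∧ Subgroup.zpowers (γ₀ ^ N) = Subgroup.zpowers (γ₁ ^ N) := by
  obtain ⟨hX, μ, hμ1, hμ⟩ := isRepelling_repellingPoint hn hlox₀
  obtain ⟨hY, ν, hν1, hν⟩ := isAttracting_attractingPoint hn hlox₀
  have hm₀ := mem_endStabilizer_of_axis hn hlox₀ hlox₀ hC hC
  have hm₁ := mem_endStabilizer_of_axis hn hlox₀ hlox₁ hC hC'
  have hspan := fun z hz => lift1_mem_span_of_axis hn hlox₀ hC (z := z) hz
  set X := repellingPoint (γ₀ : SU n)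
  set Y := attractingPoint (γ₀ : SU n)
  have hXY : X ≠ Y := by
    intro e
    rw [e] at hμ
    have := (eigenvalue_eq hμ).symm.trans (eigenvalue_eq hν)
    rw [this] at hμ1
    exact lt_asymm hμ1 hν1
  have hfix : ∀ w : endStabilizer Γ X Y, endMultiplier Γ X Y w = 1 →
      ∀ z ∈ C, act ((w : Γ) : SU n) z = z := by
    intro w hw z hz
    obtain ⟨⟨α, hα⟩, β, hβ⟩ := w.2
    rw [endMultiplier_apply w hα] at hw
    obtain ⟨a, b, e⟩ := hspan z hz
    exact act_eq_of_mem_span hX hY hXY hα hβ hw e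
  obtain ⟨N, hN, h⟩ := exists_pow_eq_of_primitive (endMultiplier Γ X Y) endMultiplier_pos
    (finite_endMultiplier_le hΓ hX hY hXY) (a := ⟨γ₀, hm₀⟩) (b := ⟨γ₁, hm₁⟩)
    (by rw [endMultiplier_apply _ hμ]; exact hμ1.ne)
    -- Multiplier 1 means fixing the axis pointwise, so primitivity in `Γ` gives primitivity
    -- relative to the kernel of the multiplier.
    (fun d w k hw e => hprim₀ C hC d w k (hfix w hw) (congrArg Subtype.val e))
    (fun d w k hw e => hprim₁ C hC' d w k (hfix w hw) (congrArg Subtype.val e))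
  refine ⟨N, hN, ?_⟩
  rcases h with h | h
  · have e : γ₀ ^ N = γ₁ ^ N := congrArg Subtype.val h
    rw [e]
  · have e : γ₀⁻¹ ^ N = γ₁ ^ N := congrArg Subtype.val h
    rw [← e, inv_pow, Subgroup.zpowers_inv]

end ComplexHyperbolic

open ComplexHyperbolic in
theorem mainTheorem5 (n : ℕ) (hn : 1 ≤ n) (Γ : Subgroup (SU n)) (hΓ : IsLattice Γ)
    (κ : ℚ) (hκ : κ ∈ admissible n) (γ₀ γ₁ : Γ)
    (hlox₀ : IsLoxodromic (γ₀ : SU n)) (hlox₁ : IsLoxodromic (γ₁ : SU n))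
    (hprim₀ : IsPrimitive γ₀) (hprim₁ : IsPrimitive γ₁)
    (haxis : ∃ C, IsAxis (γ₀ : SU n) C ∧ IsAxis (γ₁ : SU n) C)
    (h₀ : HasTheta γ₀ κ) (h₁ : HasTheta γ₁ κ) :
    (∀ z, Summable (thetaTerm γ₀ κ h₀ z)) ∧ (∀ z, Summable (thetaTerm γ₁ κ h₁ z)) ∧
      Theta γ₀ κ h₀ = Theta γ₁ κ h₁ := by
  obtain ⟨C, hC, hC'⟩ := haxis
  have hs₀ := summable_thetaTerm hn hΓ.1 hκ hlox₀ h₀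
  have hs₁ := summable_thetaTerm hn hΓ.1 hκ hlox₁ h₁
  refine ⟨hs₀, hs₁, funext fun z => ?_⟩
  obtain ⟨N, hN, e⟩ := exists_zpowers_pow_eq hn hΓ.1 hlox₀ hlox₁ hprim₀ hprim₁ hC hC'
  obtain ⟨-, μ, hμ1, hμ⟩ := isRepelling_repellingPoint hn hlox₀
  obtain ⟨-, ν, hν1, hν⟩ := isRepelling_repellingPoint hn hlox₁
  have hq : q (γ₀ : SU n) (weight n κ) = q (γ₁ : SU n) (weight n κ) := by
    unfold q
    rw [Q_eq_of_axis hn hlox₀ hlox₁ hC hC']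
  exact tsum_rightRel_eq (not_isOfFinOrder_of_eigen hμ hμ1) (not_isOfFinOrder_of_eigen hν hν1)
    hN e (fun γ : Γ => slash (weight n κ) (q (γ₀ : SU n) (weight n κ)) (γ : SU n) z)
    _ _ (fun _ => rfl) (fun _ => by rw [hq]; rfl) (hs₀ z) (hs₁ z)
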